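/- Let $K$ be a field whose characteristic is neither $2$ nor $3$. A (nonassociative, not necessarily unital) $K$-algebra is called assosymmetric if it satisfies the identities $(a,b,c)=(a,c,b)=(b,a,c)$, where $(x,y,z)=(xy)z-x(yz)$. For $r\ge 1$ let $F(r)$ be the free (nonunital) assosymmetric $K$-algebra on generators $a_1,\dots,a_r$, i.e. the quotient of the absolutely free nonassociative nonunital algebra $K\{a_1,\dots,a_r\}$ by the two-sided ideal generated by all values of $(a,b,c)-(a,c,b)$ and $(a,b,c)-(b,a,c)$. For positive integers $l_1,\dots,l_r$ let $F^{l_1,\dots,l_r}(r)\subseteq F(r)$ be the subspace spanned by the nonassociative words in which each $a_i$ occurs exactly $l_i$ times; for $n\ge 1$ let $F_n(r)\subseteq F(r)$ be the subspace spanned by the nonassociative words of degree $n$, and let $F_n^{multi}=P_n=F^{1,\dots,1}(n)$ be the multilinear part of $F_n(n)$. All these spaces are finite-dimensional, and: 1. for all $r\ge 1$ and all $l_1,\dots,l_r\ge 1$, $$\dim F^{l_1,\dots,l_r}(r)=\frac{(l_1+\cdots+l_r)!}{l_1!\cdots l_r!}+(l_1+1)\cdots(l_r+1)-\binom{r+1}{2}-r-1+w,$$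 where $w$ is the number of indices $i$ with $l_i=1$; 2. for all $r\ge 1$ and $n\ge 1$, $$\dim F_n(r)=r^n+\binom{n+2r-1}{n}-\binom{r+1}{2}\binom{n+r-3}{n-2}-r\binom{n+r-2}{n-1}-\binom{n+r-1}{n},$$ where for $n=1$ the factor $\binom{n+r-3}{n-2}=\binom{r-2}{-1}$ is read as $0$; 3. for all $n\ge 1$, $$\dim P_n=n!+2^n-\binom{n+1}{2}-1.$$ -/

import Mathlib

/-- A nonassociative ring is *assosymmetric* if its associator `(a, b, c) = (a b) c - a (b c)`
satisfies `(a, b, c) = (a, c, b) = (b, a, c)` for all `a`, `b`, `c`. -/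
def IsAssosymmetric (A : Type*) [NonUnitalNonAssocRing A] : Prop :=
  ∀ a b c : A, associator a b c = associator a c b ∧ associator a b c = associator b a c

/-- The ideal of the absolutely free nonassociative algebra `K{X}` determined by the assosymmetric
identities: the smallest two-sided ideal (a `K`-subspace closed under left and right
multiplication) that contains all the values of `(a, b, c) - (a, c, b)` and `(a, b, c) - (b, a, c)`
in `K{X}`. -/
noncomputable def assosymmetricIdeal (K X : Type*) [Field K] :
    Submodule K (FreeNonUnitalNonAssocAlgebra K X) :=
  sInf {I | (∀ a b c : FreeNonUnitalNonAssocAlgebra K X,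
                associator a b c - associator a c b ∈ I ∧
                associator a b c - associator b a c ∈ I) ∧
            ∀ x ∈ I, ∀ y : FreeNonUnitalNonAssocAlgebra K X, y * x ∈ I ∧ x * y ∈ I}

theorem mul_mem_assosymmetricIdeal {K X : Type*} [Field K]
    {x : FreeNonUnitalNonAssocAlgebra K X} (hx : x ∈ assosymmetricIdeal K X)
    (y : FreeNonUnitalNonAssocAlgebra K X) :
    y * x ∈ assosymmetricIdeal K X ∧ x * y ∈ assosymmetricIdeal K X := by
  simp only [assosymmetricIdeal, Submodule.mem_sInf] at hx ⊢
  exact ⟨fun I hI => (hI.2 x (hx I hI) y).1, fun I hI => (hI.2 x (hx I hI) y).2⟩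

theorem associator_mem_assosymmetricIdeal {K X : Type*} [Field K]
    (a b c : FreeNonUnitalNonAssocAlgebra K X) :
    associator a b c - associator a c b ∈ assosymmetricIdeal K X ∧
      associator a b c - associator b a c ∈ assosymmetricIdeal K X := by
  simp only [assosymmetricIdeal, Submodule.mem_sInf]
  exact ⟨fun I hI => (hI.1 a b c).1, fun I hI => (hI.1 a b c).2⟩

/-- The free (nonunital) assosymmetric algebra over `K` on the set `X` of generators. -/
abbrev FreeAssosymmetric (K X : Type*) [Field K] : Type _ :=
  FreeNonUnitalNonAssocAlgebra K X ⧸ assosymmetricIdeal K X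

namespace FreeAssosymmetric

/-- The canonical projection `K{X} → F(X)`, as a linear map. -/
noncomputable def proj (K X : Type*) [Field K] :
    FreeNonUnitalNonAssocAlgebra K X →ₗ[K] FreeAssosymmetric K X :=
  (assosymmetricIdeal K X).mkQ

theorem proj_surjective {K X : Type*} [Field K] : Function.Surjective (proj K X) :=
  Submodule.mkQ_surjective _

theorem proj_eq_iff {K X : Type*} [Field K] {x y : FreeNonUnitalNonAssocAlgebra K X} :
    proj K X x = proj K X y ↔ x - y ∈ assosymmetricIdeal K X :=
  Submodule.Quotient.eq _

/-- The multiplication of `F(X)`, induced by the one of `K{X}`. -/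
noncomputable instance instMul (K X : Type*) [Field K] : Mul (FreeAssosymmetric K X) where
  mul := Quotient.map₂ (· * ·) (by
    intro a a' ha b b' hb
    have ha := (Submodule.quotientRel_def _).1 ha
    have hb := (Submodule.quotientRel_def _).1 hb
    refine (Submodule.quotientRel_def _).2 ?_
    have h : a * b - a' * b' = (a - a') * b + a' * (b - b') := by
      rw [sub_mul, mul_sub]; abel
    rw [h]
    exact add_mem (mul_mem_assosymmetricIdeal ha b).2 (mul_mem_assosymmetricIdeal hb a').1)

theorem proj_mul {K X : Type*} [Field K] (x y : FreeNonUnitalNonAssocAlgebra K X) :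
    proj K X (x * y) = proj K X x * proj K X y := rfl

noncomputable instance instRing (K X : Type*) [Field K] : NonUnitalNonAssocRing (FreeAssosymmetric K X) where
  toAddCommGroup := inferInstance
  toMul := instMul K X
  left_distrib a b c := by
    obtain ⟨a, rfl⟩ := proj_surjective a
    obtain ⟨b, rfl⟩ := proj_surjective b
    obtain ⟨c, rfl⟩ := proj_surjective c
    simp only [← map_add, ← proj_mul, mul_add]
  right_distrib a b c := by
    obtain ⟨a, rfl⟩ := proj_surjective a
    obtain ⟨b, rfl⟩ := proj_surjective b
    obtain ⟨c, rfl⟩ := proj_surjective c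
    simp only [← map_add, ← proj_mul, add_mul]
  zero_mul a := by
    obtain ⟨a, rfl⟩ := proj_surjective a
    rw [← map_zero (proj K X), ← proj_mul, zero_mul]
  mul_zero a := by
    obtain ⟨a, rfl⟩ := proj_surjective a
    rw [← map_zero (proj K X), ← proj_mul, mul_zero]

instance instIsScalarTower (K X : Type*) [Field K] :
    IsScalarTower K (FreeAssosymmetric K X) (FreeAssosymmetric K X) where
  smul_assoc k a b := by
    obtain ⟨a, rfl⟩ := proj_surjective a
    obtain ⟨b, rfl⟩ := proj_surjective b
    simp only [smul_eq_mul, ← map_smul, ← proj_mul, smul_mul_assoc]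

instance instSMulCommClass (K X : Type*) [Field K] :
    SMulCommClass K (FreeAssosymmetric K X) (FreeAssosymmetric K X) where
  smul_comm k a b := by
    obtain ⟨a, rfl⟩ := proj_surjective a
    obtain ⟨b, rfl⟩ := proj_surjective b
    simp only [smul_eq_mul, ← map_smul, ← proj_mul, mul_smul_comm]

theorem isAssosymmetric (K X : Type*) [Field K] : IsAssosymmetric (FreeAssosymmetric K X) := by
  have key : ∀ a b c : FreeNonUnitalNonAssocAlgebra K X,
      associator (proj K X a) (proj K X b) (proj K X c) = proj K X (associator a b c) := by
    intro a b c
    simp only [associator_apply, map_sub, proj_mul]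
  intro a b c
  obtain ⟨a, rfl⟩ := proj_surjective a
  obtain ⟨b, rfl⟩ := proj_surjective b
  obtain ⟨c, rfl⟩ := proj_surjective c
  simp only [key, proj_eq_iff]
  exact associator_mem_assosymmetricIdeal a b c

/-- The generator of `F(X)` given by `x : X`. -/
noncomputable def gen (K : Type*) {X : Type*} [Field K] (x : X) : FreeAssosymmetric K X :=
  proj K X (FreeNonUnitalNonAssocAlgebra.of K x)

/-- The universal property of `F(X)` among assosymmetric `K`-algebras. -/
theorem existsUnique_lift {K X A : Type*} [Field K] [NonUnitalNonAssocRing A] [Module K A]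
    [IsScalarTower K A A] [SMulCommClass K A A] (hA : IsAssosymmetric A) (f : X → A) :
    ∃! φ : FreeAssosymmetric K X →ₙₐ[K] A, ∀ x, φ (gen K x) = f x := by
  let g := FreeNonUnitalNonAssocAlgebra.lift K f
  have hassoc : ∀ a b c, g (associator a b c) = associator (g a) (g b) (g c) := by
    intro a b c
    simp only [associator_apply, map_sub, map_mul]
  let g' : FreeNonUnitalNonAssocAlgebra K X →ₗ[K] A :=
    { toFun := g, map_add' := map_add g, map_smul' := map_smul g }
  have hg' : ∀ a, g' a = g a := fun a => rfl
  have hker : assosymmetricIdeal K X ≤ LinearMap.ker g' := by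
    refine sInf_le ⟨fun a b c => ?_, fun x hx y => ?_⟩
    · simp only [LinearMap.mem_ker, hg', map_sub, hassoc, sub_eq_zero]
      exact hA _ _ _
    · simp only [LinearMap.mem_ker, hg', map_mul] at hx ⊢
      simp [hx]
  let l : FreeAssosymmetric K X →ₗ[K] A := (assosymmetricIdeal K X).liftQ _ hker
  have hl : ∀ a, l (proj K X a) = g a := fun a => rfl
  refine ⟨{ toFun := l, map_smul' := map_smul l, map_zero' := map_zero l, map_add' := map_add l,
            map_mul' := fun a b => ?_ }, fun x => ?_, fun ψ hψ => ?_⟩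
  · obtain ⟨a, rfl⟩ := proj_surjective a
    obtain ⟨b, rfl⟩ := proj_surjective b
    simp only [← proj_mul, hl, map_mul]
  · exact (hl _).trans (FreeNonUnitalNonAssocAlgebra.lift_of_apply K f x)
  · let π : FreeNonUnitalNonAssocAlgebra K X →ₙₐ[K] FreeAssosymmetric K X :=
      { toFun := proj K X, map_smul' := map_smul _, map_zero' := map_zero _, map_add' := map_add _,
        map_mul' := proj_mul }
    have h : ψ.comp π = g := by
      refine FreeNonUnitalNonAssocAlgebra.hom_ext K fun x => ?_
      exact (hψ x).trans (FreeNonUnitalNonAssocAlgebra.lift_of_apply K f x).symm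
    ext a
    obtain ⟨a, rfl⟩ := proj_surjective a
    exact DFunLike.congr_fun h a

/-- The value in `F(X)` of a nonassociative word in the generators. -/
noncomputable def word (K : Type*) {X : Type*} [Field K] (w : FreeMagma X) : FreeAssosymmetric K X :=
  FreeMagma.lift (gen K) w

/-- The number of occurrences of the generator `i` in a nonassociative word. -/
def occ {X : Type*} [DecidableEq X] (i : X) : FreeMagma X → ℕ
  | .of j => if j = i then 1 else 0
  | .mul u v => occ i u + occ i v

/-- `F^{l_1,…,l_r}(r)`: the subspace of the free assosymmetric algebra on `r` generators spanned by
the nonassociative words in which the `i`-th generator occurs exactly `l i` times, for all `i`. -/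
noncomputable def multiComponent (K : Type*) [Field K] {r : ℕ} (l : Fin r → ℕ) :
    Submodule K (FreeAssosymmetric K (Fin r)) :=
  Submodule.span K {x | ∃ w : FreeMagma (Fin r), (∀ i, occ i w = l i) ∧ word K w = x}

/-- `F_n(r)`: the subspace of the free assosymmetric algebra on `r` generators spanned by the
nonassociative words of degree `n` in the generators. -/
noncomputable def degComponent (K : Type*) [Field K] (r n : ℕ) :
    Submodule K (FreeAssosymmetric K (Fin r)) :=
  Submodule.span K {x | ∃ w : FreeMagma (Fin r), w.length = n ∧ word K w = x}

/-- `P_n = F^{1,…,1}(n)`: the multilinear part of the free assosymmetric algebra on `n`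
generators. -/
noncomputable abbrev multilinearPart (K : Type*) [Field K] (n : ℕ) :
    Submodule K (FreeAssosymmetric K (Fin n)) :=
  multiComponent K fun _ : Fin n => 1

end FreeAssosymmetric

/-! Let `A` be assosymmetric without 2- or 3-torsion. The cocycle identity for associators, combined
with their symmetry, forces the derivation rule `(wx, y, z) = w(x, y, z) + (w, y, z)x`
(`associator_mul`) and kills `([w, x], y, z)`. It follows that every associator `d` satisfies `(d,
y, z) = 0` and is annihilated by commutators on both sides (`isNuclear_associator`), and that these
properties survive multiplication by elements of `A`. The ideal generated by associators is
therefore an associative bimodule on which left multiplications commute among themselves, and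
likewise right multiplications.

Modulo this ideal every word is a right-normed word. The ideal itself is spanned by elements
`a₁(⋯(aₖ[⋯[(x, y, z), w₁], ⋯]))` that depend only on the multiset `a` of left multipliers and the
multiset `b` of letters in the tower, with `|b| ≥ 3`.

Independence comes from a concrete algebra on `K⟨X⟩ × K[u, v]`: right-normed words go to distinct
monomials of `K⟨X⟩`, and the element of the pair `(a, b)` goes to the monomial `u^a v^b`. The
dimensions are then counts of words plus counts of pairs `(a, b)` with `|b| ≥ 3`; the negative terms
of the formulas remove the pairs with `|b| = 0, 1, 2`. -/

namespace IsAssosymmetric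

/-! ### Associator identities without 2-torsion -/

variable {A : Type*} [NonUnitalNonAssocRing A]

theorem swap_right (hA : IsAssosymmetric A) (a b c : A) :
    associator a b c = associator a c b := (hA a b c).1

theorem swap_left (hA : IsAssosymmetric A) (a b c : A) :
    associator a b c = associator b a c := (hA a b c).2

theorem swap_outer (hA : IsAssosymmetric A) (a b c : A) :
    associator a b c = associator c b a := by
  rw [hA.swap_left, hA.swap_right, hA.swap_left]

theorem associator_add_left (a b c d : A) :
    associator (a + b) c d = associator a c d + associator b c d := by
  simp only [associator_apply, add_mul]; abel

theorem associator_sub_left (a b c d : A) :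
    associator (a - b) c d = associator a c d - associator b c d := by
  simp only [associator_apply, sub_mul]; abel

theorem rotate (hA : IsAssosymmetric A) (a b c : A) :
    associator b c a = associator a b c := by
  rw [hA.swap_right, hA.swap_left]

/-- In any ring the right-hand side equals `(a, b, c) - (a, c, b) + (c, a, b)`, and symmetry
collapses this to one associator. -/
theorem associator_eq_commutators (hA : IsAssosymmetric A) (a b c : A) :
    associator a b c = ((a * b) * c - c * (a * b)) - a * (b * c - c * b)
      - (a * c - c * a) * b := by
  have e1 := hA.swap_right a b c
  have e2 := hA.rotate c a b
  simp only [associator_apply, mul_sub, sub_mul] at *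
  linear_combination (norm := abel) e2 - e1

theorem teichmuller (hA : IsAssosymmetric A) (w x y z : A) :
    w * associator x y z + associator w x y * z =
      associator (w * x) y z - associator (x * y) w z + associator (y * z) w x := by
  have h := associator_cocycle w x y z
  rw [hA.swap_left w (x * y) z, hA.swap_right w x (y * z), hA.swap_left w (y * z) x] at h
  linear_combination (norm := abel) h

/-- The difference of the Teichmüller identities for `w, x, y, z` and for the reversed sequence `z,
y, x, w`. -/
theorem associator_commutator_cycle (hA : IsAssosymmetric A) (w x y z : A) :
    associator (w * x - x * w) y z - associator (x * y - y * x) w z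
      + associator (y * z - z * y) w x =
    (associator w x y * z - z * associator w x y)
      - (associator x y z * w - w * associator x y z) := by
  have h1 := hA.teichmuller w x y z
  have h2 := hA.teichmuller z y x w
  simp only [associator_sub_left]
  simp only [hA.swap_right, hA.swap_left] at *
  linear_combination (norm := abel) h2 - h1

/-- Write `C(w, x)` for the left side, a skew function of `w, x` once the four letters are fixed.
Two cycle relations yield `C(y, z) - C(w, z)` (`key`), and three instances of that combine to `2
C(w, x)`. -/
theorem associator_commutator_eq (hA : IsAssosymmetric A) (h2 : ∀ a : A, a + a = 0 → a = 0)
    (w x y z : A) :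
    associator (w * x - x * w) y z =
      (associator x y z * w - w * associator x y z)
        - (associator w y z * x - x * associator w y z) := by
  have key : ∀ y w z x : A, associator (y * z - z * y) x w - associator (w * z - z * w) x y =
      (associator w z x * y - y * associator w z x)
        - (associator y z x * w - w * associator y z x) := by
    intro y w z x
    have e1 := hA.associator_commutator_cycle w x y z
    have e2 := hA.associator_commutator_cycle y x w z
    simp only [associator_sub_left] at *
    simp only [hA.swap_right, hA.swap_left] at *
    linear_combination (norm := abel) e1 - e2
  rw [← sub_eq_zero]
  apply h2
  have e1 := key w x y z
  have e2 := key y x w z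
  have e3 := key y w x z
  simp only [associator_sub_left] at *
  simp only [hA.swap_right, hA.swap_left] at *
  linear_combination (norm := abel) e1 + e2 - e3

/-- With `D(w) = [(x, y, z), w]` and so on, the previous lemma reads `C(w, x) = D(w) - D(x)`. The
cycle relation becomes `2(D(w) - D(x) + D(y) - D(z)) = 0`; adding its instance with `y` and `z`
exchanged gives `4(D(w) - D(x)) = 0`. -/
theorem commutator_associator_comm (hA : IsAssosymmetric A) (h2 : ∀ a : A, a + a = 0 → a = 0)
    (w x y z : A) :
    associator x y z * w - w * associator x y z = associator w y z * x - x * associator w y z := by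
  rw [← sub_eq_zero]
  apply h2
  apply h2
  have e1 := hA.associator_commutator_cycle w x y z
  have e2 := hA.associator_commutator_cycle w x z y
  simp only [hA.associator_commutator_eq h2] at e1 e2
  simp only [hA.swap_right, hA.swap_left] at *
  linear_combination (norm := abel) e1 + e2

theorem associator_commutator (hA : IsAssosymmetric A) (h2 : ∀ a : A, a + a = 0 → a = 0)
    (w x y z : A) : associator (w * x - x * w) y z = 0 := by
  rw [hA.associator_commutator_eq h2, hA.commutator_associator_comm h2, sub_self]

theorem associator_mul_comm (hA : IsAssosymmetric A) (h2 : ∀ a : A, a + a = 0 → a = 0)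
    (w x y z : A) : associator (w * x) y z = associator (x * w) y z := by
  have h := hA.associator_commutator h2 w x y z
  rwa [associator_sub_left, sub_eq_zero] at h

/-- The defect `E` is symmetric in its first two and in its last two arguments, so it has six values
on four letters. The relation `hT` has a left side depending only on the pairing `{w, x}, {y, z}`,
so all six values coincide, and then `2E = E`. -/
theorem associator_mul (hA : IsAssosymmetric A) (h2 : ∀ a : A, a + a = 0 → a = 0)
    (w x y z : A) :
    associator (w * x) y z = w * associator x y z + associator w y z * x := by
  obtain ⟨E, hE⟩ : ∃ E : A → A → A → A → A, ∀ w x y z, E w x y z =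
    associator (w * x) y z - w * associator x y z - associator w y z * x :=
    ⟨_, fun _ _ _ _ => rfl⟩
  have hs : ∀ w x y z, E w x y z = E x w y z := by
    intro w x y z
    have e := hA.commutator_associator_comm h2 w x y z
    rw [hE, hE, hA.associator_mul_comm h2]
    linear_combination (norm := abel) e
  have hr : ∀ w x y z, E w x y z = E w x z y := by
    intro w x y z
    rw [hE, hE, hA.swap_right (w * x), hA.swap_right x, hA.swap_right w]
  have hT : ∀ w x y z, E w x y z + E y z w x = E x y w z := by
    intro w x y z
    have e1 := hA.commutator_associator_comm h2 x y w z
    have e2 := hA.teichmuller w x y z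
    simp only [hE]
    simp only [hA.swap_right, hA.swap_left] at *
    linear_combination (norm := abel) -e1 - e2
  have h : E w x y z = 0 := by
    apply h2
    have e1 := hT w x y z
    have e2 := hT z x y w
    have e3 := hT w x z y
    have e4 := hT z w y x
    have e5 := hT x w y z
    have e6 := hT x y z w
    simp only [hs, hr] at *
    grind
  rw [hE] at h
  linear_combination (norm := abel) h

/-! ### Nuclearity of the associator ideal -/

/-- `d` behaves as an element of an associative bimodule on which commutators act by zero. -/
structure IsNuclear (d : A) : Prop where
  associator_eq_zero : ∀ y z, associator d y z = 0
  commutator_mul : ∀ b c, (b * c - c * b) * d = 0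
  mul_commutator : ∀ b c, d * (b * c - c * b) = 0

/-- The derivation rule expands both sides of `([b, c]a, y, z) = (a[b, c], y, z)`, and the terms
containing `([b, c], y, z)` vanish. -/
theorem commutator_mul_associator (hA : IsAssosymmetric A) (h2 : ∀ a : A, a + a = 0 → a = 0)
    (a b c y z : A) :
    (b * c - c * b) * associator a y z = associator a y z * (b * c - c * b) := by
  have e := hA.associator_mul_comm h2 (b * c - c * b) a y z
  rw [hA.associator_mul h2, hA.associator_mul h2, hA.associator_commutator h2] at e
  simpa using e

theorem associator_associator_eq (hA : IsAssosymmetric A) (h2 : ∀ a : A, a + a = 0 → a = 0)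
    (a b c y z : A) : associator (associator a b c) y z =
      (c * b - b * c) * associator a y z + (c * a - a * c) * associator b y z := by
  rw [hA.associator_eq_commutators a b c]
  simp only [associator_sub_left]
  rw [← associator_sub_left, hA.associator_commutator h2, hA.associator_mul h2 a,
    hA.associator_mul h2 _ b, hA.associator_commutator h2, hA.associator_commutator h2,
    ← hA.commutator_mul_associator h2]
  simp only [sub_mul, zero_mul, mul_zero]
  abel

theorem isNuclear_associator (hA : IsAssosymmetric A) (h2 : ∀ a : A, a + a = 0 → a = 0)
    (h3 : ∀ a : A, a + a + a = 0 → a = 0) (a b c : A) : IsNuclear (associator a b c) := by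
  have h0 : ∀ a b c y z : A, associator (associator a b c) y z = 0 := by
    -- The inner associator is invariant under cyclic shifts of `a, b, c`, while the right-hand
    -- sides of the three shifted identities sum to zero.
    intro a b c y z
    apply h3
    have e1 := hA.associator_associator_eq h2 a b c y z
    have e2 := hA.associator_associator_eq h2 b c a y z
    have e3 := hA.associator_associator_eq h2 c a b y z
    rw [hA.rotate a b c] at e2
    rw [hA.rotate b c a, hA.rotate a b c] at e3
    simp only [sub_mul] at *
    linear_combination (norm := abel) e1 + e2 + e3
  have hc : ∀ a b c y z : A,
      (b * c - c * b) * associator a y z = (c * a - a * c) * associator b y z := by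
    intro a b c y z
    have e := hA.associator_associator_eq h2 a b c y z
    rw [h0] at e
    simp only [sub_mul] at *
    linear_combination (norm := abel) e
  have hz : ∀ a b c y z : A, (b * c - c * b) * associator a y z = 0 := by
    intro a b c y z
    -- For fixed `c, z`, the expression `[b, c](a, y, z)` is symmetric in `a, y` and, by `hc`, skew
    -- in `a, b`. Three alternating exchanges return it with the opposite sign.
    have hl : ∀ a b c y, (b * c - c * b) * associator a y z
        = (c * a - a * c) * associator y b z := by
      intro a b c y
      rw [hc, hA.swap_left]
    apply h2
    have e1 := hl a b c y
    have e2 := hl y a c b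
    have e3 := hl b y c a
    simp only [sub_mul] at *
    linear_combination (norm := abel) e1 - e2 + e3
  refine ⟨h0 a b c, fun x y => hz a x y b c, fun x y => ?_⟩
  rw [← hA.commutator_mul_associator h2, hz]

namespace IsNuclear

theorem zero : IsNuclear (0 : A) := by
  constructor <;> intros <;> simp [associator_apply]

theorem add {d e : A} (hd : IsNuclear d) (he : IsNuclear e) : IsNuclear (d + e) := by
  refine ⟨fun y z => ?_, fun b c => ?_, fun b c => ?_⟩
  · rw [associator_add_left, hd.1, he.1, add_zero]
  · rw [mul_add, hd.2, he.2, add_zero]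
  · rw [add_mul, hd.3, he.3, add_zero]

theorem sub {d e : A} (hd : IsNuclear d) (he : IsNuclear e) : IsNuclear (d - e) := by
  refine ⟨fun y z => ?_, fun b c => ?_, fun b c => ?_⟩
  · rw [associator_sub_left, hd.1, he.1, sub_zero]
  · rw [mul_sub, hd.2, he.2, sub_zero]
  · rw [sub_mul, hd.3, he.3, sub_zero]

variable {d : A}

theorem mul_assoc_left (hd : IsNuclear d) (x y : A) : d * x * y = d * (x * y) :=
  sub_eq_zero.1 (hd.1 x y)

theorem mul_assoc_mid (hA : IsAssosymmetric A) (hd : IsNuclear d) (x y : A) :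
    x * d * y = x * (d * y) := by
  rw [← sub_eq_zero, ← associator_apply, hA.swap_left, hd.1]

theorem mul_assoc_right (hA : IsAssosymmetric A) (hd : IsNuclear d) (x y : A) :
    x * y * d = x * (y * d) := by
  rw [← sub_eq_zero, ← associator_apply, hA.swap_outer, hd.1]

theorem mul_comm_left (hd : IsNuclear d) (x y : A) : d * (x * y) = d * (y * x) := by
  rw [← sub_eq_zero, ← mul_sub, hd.3]

theorem mul_comm_right (hd : IsNuclear d) (x y : A) : (x * y) * d = (y * x) * d := by
  rw [← sub_eq_zero, ← sub_mul, hd.2]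

theorem left_comm (hA : IsAssosymmetric A) (hd : IsNuclear d) (x y : A) :
    x * (y * d) = y * (x * d) := by
  rw [← hd.mul_assoc_right hA, hd.mul_comm_right, hd.mul_assoc_right hA]

theorem right_comm (hd : IsNuclear d) (x y : A) : d * x * y = d * y * x := by
  rw [hd.mul_assoc_left, hd.mul_comm_left, hd.mul_assoc_left]

/-- Expanding `(a, b, c)` in commutators leaves only `-(da)[b, c]`, which symmetry of `(da, b, c)`
rewrites as in `key`. In the cyclic sum everything cancels by `right_comm`, leaving `3 d(a, b, c) =
0`. -/
theorem mul_associator (hA : IsAssosymmetric A)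
    (h3 : ∀ a : A, a + a + a = 0 → a = 0) (hd : IsNuclear d) (a b c : A) :
    d * associator a b c = 0 := by
  have key : ∀ a b c, d * associator a b c = d * a * c * b - d * a * b * c := by
    intro a b c
    have e2 := hA.swap_right (d * a) b c
    rw [hA.associator_eq_commutators a b c, mul_sub, mul_sub, hd.3, ← hd.mul_assoc_left,
      ← hd.mul_assoc_left, hd.3]
    simp only [associator_apply, mul_sub, zero_mul] at *
    linear_combination (norm := abel) e2
  apply h3
  have e1 := key a b c
  have e2 := key b c a
  have e3 := key c a b
  rw [hA.rotate a b c] at e2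
  rw [hA.rotate b c a, hA.rotate a b c] at e3
  rw [hd.right_comm c a, hd.right_comm c b] at e3
  rw [hd.right_comm b a] at e2
  linear_combination (norm := abel) e1 + e2 + e3

theorem associator_mul (hA : IsAssosymmetric A) (h2 : ∀ a : A, a + a = 0 → a = 0)
    (h3 : ∀ a : A, a + a + a = 0 → a = 0) (hd : IsNuclear d) (a b c : A) :
    associator a b c * d = 0 := by
  have e := hA.commutator_associator_comm h2 d a b c
  rw [hd.mul_associator hA h3, hd.1] at e
  simpa using e

theorem mul_left (hA : IsAssosymmetric A) (h2 : ∀ a : A, a + a = 0 → a = 0)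
    (h3 : ∀ a : A, a + a + a = 0 → a = 0) (hd : IsNuclear d) (a : A) : IsNuclear (a * d) := by
  refine ⟨fun y z => ?_, fun b c => ?_, fun b c => ?_⟩
  · rw [hA.associator_mul h2, hd.1, hd.associator_mul hA h2 h3, mul_zero, add_zero]
  -- In the commutator expansion of `(b, a, c)d = 0`, every term other than `([b, c]a)d = [b,
  -- c](ad)` is already zero.
  · have e := hd.associator_mul hA h2 h3 b a c
    rw [hA.associator_eq_commutators, sub_mul, sub_mul, hd.2, hd.mul_assoc_right hA, hd.2,
      hd.mul_assoc_right hA] at e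
    simpa using e
  · rw [hd.mul_assoc_mid hA, hd.3, mul_zero]

theorem mul_right (hA : IsAssosymmetric A) (h2 : ∀ a : A, a + a = 0 → a = 0)
    (h3 : ∀ a : A, a + a + a = 0 → a = 0) (hd : IsNuclear d) (a : A) : IsNuclear (d * a) := by
  refine ⟨fun y z => ?_, fun b c => ?_, fun b c => ?_⟩
  · rw [hA.associator_mul h2, hd.1, hd.mul_associator hA h3, zero_mul, add_zero]
  · rw [← hd.mul_assoc_mid hA, hd.2, zero_mul]
  · have e := hd.mul_associator hA h3 a b c
    rw [hA.associator_eq_commutators, mul_sub, mul_sub, hd.3, ← hd.mul_assoc_left,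
      ← hd.mul_assoc_left, hd.3] at e
    simpa using e

end IsNuclear

end IsAssosymmetric

/-! ### Normal elements and their symmetry -/

set_option linter.unusedSectionVars false

namespace FreeMagma

/-- The multiset of the letters of a nonassociative word. -/
def content {X : Type*} : FreeMagma X → Multiset X
  | .of x => {x}
  | .mul u v => content u + content v

@[simp]
theorem content_mul {X : Type*} (u v : FreeMagma X) : content (u * v) = content u + content v := rfl

end FreeMagma

namespace IsAssosymmetric

section Elements

variable {A X : Type*} [NonUnitalNonAssocRing A] (g : X → A)

/-- The right-normed product of a nonempty list of generators. -/
def rightNormed : List X → A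
  | [] => 0
  | [x] => g x
  | x :: y :: t => g x * rightNormed (y :: t)

/-- The iterated commutators `[…[[(x, y, z), w₁], w₂], …]` of an associator of generators. -/
def associatorTower : List X → A
  | [] => 0
  | [_] => 0
  | [_, _] => 0
  | [x, y, z] => associator (g x) (g y) (g z)
  | w :: x :: y :: z :: t =>
    associatorTower (x :: y :: z :: t) * g w - g w * associatorTower (x :: y :: z :: t)

/-- The left multiples `a₁ (a₂ (… d))` of an iterated commutator `d` of an associator. -/
def associatorNormal (a b : List X) : A :=
  a.foldr (fun x d => g x * d) (associatorTower g b)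

theorem associatorNormal_cons (x : X) (a b : List X) :
    associatorNormal g (x :: a) b = g x * associatorNormal g a b := rfl

theorem associatorTower_cons (w : X) {b : List X} (hb : 3 ≤ b.length) :
    associatorTower g (w :: b) = associatorTower g b * g w - g w * associatorTower g b := by
  match b, hb with
  | x :: y :: z :: t, _ => rfl

theorem rightNormed_eq_lift : ∀ {l : List X}, l ≠ [] →
    ∃ w : FreeMagma X, w.content = ↑l ∧ FreeMagma.lift g w = rightNormed g l
  | [x], _ => ⟨.of x, rfl, rfl⟩
  | x :: y :: t, _ => by
    obtain ⟨w, hw, hw'⟩ := rightNormed_eq_lift (l := y :: t) (by simp)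
    refine ⟨.of x * w, ?_, ?_⟩
    · rw [FreeMagma.content_mul, hw]; rfl
    · rw [map_mul, hw']; rfl

variable {g}

theorem isNuclear_associatorTower (hA : IsAssosymmetric A) (h2 : ∀ a : A, a + a = 0 → a = 0)
    (h3 : ∀ a : A, a + a + a = 0 → a = 0) : ∀ b : List X, IsNuclear (associatorTower g b)
  | [] => .zero
  | [_] => .zero
  | [_, _] => .zero
  | [_, _, _] => hA.isNuclear_associator h2 h3 _ _ _
  | _ :: x :: y :: z :: t =>
    have ih := isNuclear_associatorTower hA h2 h3 (x :: y :: z :: t)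
    (ih.mul_right hA h2 h3 _).sub (ih.mul_left hA h2 h3 _)

theorem isNuclear_associatorNormal (hA : IsAssosymmetric A) (h2 : ∀ a : A, a + a = 0 → a = 0)
    (h3 : ∀ a : A, a + a + a = 0 → a = 0) (b : List X) :
    ∀ a : List X, IsNuclear (associatorNormal g a b)
  | [] => isNuclear_associatorTower hA h2 h3 b
  | _ :: a => (isNuclear_associatorNormal hA h2 h3 b a).mul_left hA h2 h3 _

/-- Four letters are the case of `commutator_associator_comm`. Above a nuclear tower, the operators
`d ↦ [d, g x]` commute because left and right multiplications do. -/
theorem associatorTower_swap (hA : IsAssosymmetric A) (h2 : ∀ a : A, a + a = 0 → a = 0)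
    (h3 : ∀ a : A, a + a + a = 0 → a = 0) (x y : X) :
    ∀ b : List X, associatorTower g (x :: y :: b) = associatorTower g (y :: x :: b)
  | [] => rfl
  | [_] => hA.swap_left _ _ _
  | [z, w] => by
    simp only [associatorTower]
    exact (hA.commutator_associator_comm h2 _ _ _ _)
  | u :: v :: w :: t => by
    have hd := isNuclear_associatorTower (g := g) hA h2 h3 (u :: v :: w :: t)
    simp only [associatorTower, sub_mul, mul_sub]
    rw [hd.right_comm, hd.mul_assoc_mid hA, hd.mul_assoc_mid hA, hd.left_comm hA (g x)]
    abel

theorem associatorTower_perm (hA : IsAssosymmetric A) (h2 : ∀ a : A, a + a = 0 → a = 0)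
    (h3 : ∀ a : A, a + a + a = 0 → a = 0) {b b' : List X} (h : b.Perm b') :
    associatorTower g b = associatorTower g b' := by
  induction h with
  | nil => rfl
  | swap x y l => exact associatorTower_swap hA h2 h3 _ _ _
  | trans _ _ h1 h2 => exact h1.trans h2
  | @cons x l l' h ih =>
    have hl := h.length_eq
    match l, l', h with
    | [], [], _ => rfl
    | [_], [_], _ => rfl
    | [a, b], [a', b'], h =>
      have : (a = a' ∧ b = b') ∨ (a = b' ∧ b = a') := by
        have h := Multiset.coe_eq_coe.2 h
        simp only [← Multiset.cons_coe, Multiset.cons_eq_cons] at h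
        aesop
      rcases this with ⟨rfl, rfl⟩ | ⟨rfl, rfl⟩
      · rfl
      · exact hA.swap_right _ _ _
    | u :: v :: w :: t, l', _ =>
      rw [associatorTower_cons g x (by simp), associatorTower_cons g x (by rw [← hl]; simp), ih]

theorem associatorNormal_perm (hA : IsAssosymmetric A) (h2 : ∀ a : A, a + a = 0 → a = 0)
    (h3 : ∀ a : A, a + a + a = 0 → a = 0) {a a' b b' : List X} (h : a.Perm a') (h' : b.Perm b') :
    associatorNormal g a b = associatorNormal g a' b' := by
  have hb : ∀ a, associatorNormal g a b = associatorNormal g a b' := by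
    simp only [associatorNormal, associatorTower_perm hA h2 h3 h', implies_true]
  rw [hb]
  induction h with
  | nil => rfl
  | swap x y l =>
    simp only [associatorNormal_cons]
    exact (isNuclear_associatorNormal hA h2 h3 _ _).left_comm hA _ _
  | trans _ _ e e' => exact e.trans e'
  | cons x h ih =>
    simp only [associatorNormal_cons]
    rw [ih]

end Elements

/-! ### Normal elements span -/

section Span

variable (K : Type*) {A X : Type*} [Field K] [NonUnitalNonAssocRing A] [Module K A]
  [IsScalarTower K A A] [SMulCommClass K A A] (g : X → A)

/-- The span of the values of the nonassociative words with a given content. -/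
def wordSpan (d : Multiset X) : Submodule K A :=
  Submodule.span K {p | ∃ w : FreeMagma X, w.content = d ∧ FreeMagma.lift g w = p}

/-- The span of the normal elements of a given content in the associator ideal. -/
def associatorSpan (d : Multiset X) : Submodule K A :=
  Submodule.span K {p | ∃ a b : List X, 3 ≤ b.length ∧ (a : Multiset X) + b = d ∧
    associatorNormal g a b = p}

/-- The span of all the normal elements of a given content. -/
def normalSpan (d : Multiset X) : Submodule K A :=
  Submodule.span K {p | ∃ l : List X, l ≠ [] ∧ (l : Multiset X) = d ∧ rightNormed g l = p}
    ⊔ associatorSpan K g d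

variable {K g}

theorem gen_mem_wordSpan (x : X) : g x ∈ wordSpan K g {x} :=
  Submodule.subset_span ⟨.of x, rfl, rfl⟩

theorem mul_mem_wordSpan {c d : Multiset X} {p q : A} (hp : p ∈ wordSpan K g c)
    (hq : q ∈ wordSpan K g d) : p * q ∈ wordSpan K g (c + d) := by
  induction hp, hq using Submodule.span_induction₂ with
  | mem_mem p q hp hq =>
    obtain ⟨u, rfl, rfl⟩ := hp
    obtain ⟨v, rfl, rfl⟩ := hq
    exact Submodule.subset_span ⟨u * v, rfl, map_mul _ _ _⟩
  | zero_left => rw [zero_mul]; exact zero_mem _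
  | zero_right => rw [mul_zero]; exact zero_mem _
  | add_left _ _ _ _ _ _ h h' => rw [add_mul]; exact add_mem h h'
  | add_right _ _ _ _ _ _ h h' => rw [mul_add]; exact add_mem h h'
  | smul_left r _ _ _ _ h => rw [smul_mul_assoc]; exact Submodule.smul_mem _ _ h
  | smul_right r _ _ _ _ h => rw [mul_smul_comm]; exact Submodule.smul_mem _ _ h

theorem associatorTower_mem_wordSpan : ∀ b : List X, associatorTower g b ∈ wordSpan K g ↑b
  | [] => zero_mem _
  | [_] => zero_mem _
  | [_, _] => zero_mem _
  | [x, y, z] => by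
    have h1 := mul_mem_wordSpan (K := K) (mul_mem_wordSpan (gen_mem_wordSpan (g := g) x)
      (gen_mem_wordSpan y)) (gen_mem_wordSpan z)
    have h2 := mul_mem_wordSpan (K := K) (gen_mem_wordSpan (g := g) x) (mul_mem_wordSpan
      (gen_mem_wordSpan y) (gen_mem_wordSpan z))
    rw [add_assoc] at h1
    exact sub_mem h1 h2
  | w :: x :: y :: z :: t => by
    have ih := associatorTower_mem_wordSpan (x :: y :: z :: t)
    have h1 := mul_mem_wordSpan (gen_mem_wordSpan w) ih
    have h2 := mul_mem_wordSpan ih (gen_mem_wordSpan w)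
    rw [add_comm] at h2
    exact sub_mem h2 h1

theorem associatorNormal_mem_wordSpan (b : List X) :
    ∀ a : List X, associatorNormal g a b ∈ wordSpan K g (↑a + ↑b)
  | [] => by
    rw [Multiset.coe_nil, zero_add]
    exact associatorTower_mem_wordSpan b
  | x :: a => by
    have h := mul_mem_wordSpan (gen_mem_wordSpan (K := K) x) (associatorNormal_mem_wordSpan b a)
    rwa [← add_assoc] at h

theorem rightNormed_mem_wordSpan {l : List X} (hl : l ≠ []) : rightNormed g l ∈ wordSpan K g ↑l :=
  Submodule.subset_span (rightNormed_eq_lift g hl)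

theorem isNuclear_of_mem_associatorSpan (hA : IsAssosymmetric A)
    (h2 : ∀ a : A, a + a = 0 → a = 0) (h3 : ∀ a : A, a + a + a = 0 → a = 0) {d : Multiset X}
    {p : A} (hp : p ∈ associatorSpan K g d) : IsNuclear p := by
  induction hp using Submodule.span_induction with
  | mem p hp =>
    obtain ⟨a, b, -, -, rfl⟩ := hp
    exact isNuclear_associatorNormal hA h2 h3 b a
  | zero => exact .zero
  | add _ _ _ _ h h' => exact h.add h'
  | smul r p _ h =>
    refine ⟨fun y z => ?_, fun b c => ?_, fun b c => ?_⟩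
    · have := h.associator_eq_zero y z
      rw [associator_apply] at this
      rw [associator_apply, smul_mul_assoc, smul_mul_assoc, smul_mul_assoc, ← smul_sub, this,
        smul_zero]
    · rw [mul_smul_comm, h.commutator_mul, smul_zero]
    · rw [smul_mul_assoc, h.mul_commutator, smul_zero]

theorem gen_mul_mem_associatorSpan (x : X) {d : Multiset X} {p : A}
    (hp : p ∈ associatorSpan K g d) : g x * p ∈ associatorSpan K g ({x} + d) := by
  induction hp using Submodule.span_induction with
  | mem p hp =>
    obtain ⟨a, b, hb, rfl, rfl⟩ := hp
    exact Submodule.subset_span ⟨x :: a, b, hb, by rw [← add_assoc]; rfl, rfl⟩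
  | zero => rw [mul_zero]; exact zero_mem _
  | add _ _ _ _ h h' => rw [mul_add]; exact add_mem h h'
  | smul r _ _ h => rw [mul_smul_comm]; exact Submodule.smul_mem _ _ h

theorem mul_gen_mem_associatorSpan (hA : IsAssosymmetric A)
    (h2 : ∀ a : A, a + a = 0 → a = 0) (h3 : ∀ a : A, a + a + a = 0 → a = 0) (x : X)
    {d : Multiset X} {p : A}
    (hp : p ∈ associatorSpan K g d) : p * g x ∈ associatorSpan K g (d + {x}) := by
  induction hp using Submodule.span_induction with
  | mem p hp =>
    obtain ⟨a, b, hb, rfl, rfl⟩ := hp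
    induction a with
    | nil =>
      -- Right multiplication is commutator plus left multiplication: the commutator lengthens the
      -- tower, the other term lengthens the left part.
      have e : associatorNormal g [] b * g x =
          associatorNormal g [] (x :: b) + associatorNormal g [x] b := by
        rw [associatorNormal_cons]
        simp only [associatorNormal, List.foldr_nil, associatorTower_cons g x hb]
        abel
      rw [e]
      refine add_mem (Submodule.subset_span ⟨[], x :: b, by simp; omega, ?_, rfl⟩)
        (Submodule.subset_span ⟨[x], b, hb, ?_, rfl⟩)
      · simp only [← Multiset.cons_coe, Multiset.coe_nil, ← Multiset.singleton_add]; abel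
      · simp only [← Multiset.cons_coe, Multiset.coe_nil, ← Multiset.singleton_add]; abel
    | cons y a ih =>
      rw [associatorNormal_cons, (isNuclear_associatorNormal hA h2 h3 b a).mul_assoc_mid hA]
      have := gen_mul_mem_associatorSpan y ih
      rwa [← add_assoc, ← add_assoc] at this
  | zero => rw [zero_mul]; exact zero_mem _
  | add _ _ _ _ h h' => rw [add_mul]; exact add_mem h h'
  | smul r _ _ h => rw [smul_mul_assoc]; exact Submodule.smul_mem _ _ h

theorem lift_mul_mem_associatorSpan (hA : IsAssosymmetric A)
    (h2 : ∀ a : A, a + a = 0 → a = 0) (h3 : ∀ a : A, a + a + a = 0 → a = 0) (w : FreeMagma X)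
    {d : Multiset X} {p : A} (hp : p ∈ associatorSpan K g d) :
    FreeMagma.lift g w * p ∈ associatorSpan K g (w.content + d) := by
  induction w generalizing d p with
  | ih1 x => exact gen_mul_mem_associatorSpan x hp
  | ih2 u v hu hv =>
    rw [map_mul, (isNuclear_of_mem_associatorSpan hA h2 h3 hp).mul_assoc_right hA,
      FreeMagma.content_mul, add_assoc]
    exact hu (hv hp)

theorem mul_lift_mem_associatorSpan (hA : IsAssosymmetric A)
    (h2 : ∀ a : A, a + a = 0 → a = 0) (h3 : ∀ a : A, a + a + a = 0 → a = 0) (w : FreeMagma X)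
    {d : Multiset X} {p : A} (hp : p ∈ associatorSpan K g d) :
    p * FreeMagma.lift g w ∈ associatorSpan K g (d + w.content) := by
  induction w generalizing d p with
  | ih1 x => exact mul_gen_mem_associatorSpan hA h2 h3 x hp
  | ih2 u v hu hv =>
    rw [map_mul, ← (isNuclear_of_mem_associatorSpan hA h2 h3 hp).mul_assoc_left,
      FreeMagma.content_mul, ← add_assoc]
    exact hv (hu hp)

/-- The derivation rule reduces one slot from a word to its letters; symmetry of the associator
later brings each slot to the front in turn. -/
theorem associator_lift_left_mem (hA : IsAssosymmetric A)
    (h2 : ∀ a : A, a + a = 0 → a = 0) (h3 : ∀ a : A, a + a + a = 0 → a = 0) {y z : A}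
    {e : Multiset X} (h : ∀ x, associator (g x) y z ∈ associatorSpan K g ({x} + e))
    (w : FreeMagma X) :
    associator (FreeMagma.lift g w) y z ∈ associatorSpan K g (w.content + e) := by
  induction w with
  | ih1 x => exact h x
  | ih2 u v hu hv =>
    rw [map_mul, hA.associator_mul h2, FreeMagma.content_mul]
    refine add_mem ?_ ?_
    · rw [add_assoc]
      exact lift_mul_mem_associatorSpan hA h2 h3 u hv
    · rw [add_assoc, add_comm v.content, ← add_assoc]
      exact mul_lift_mem_associatorSpan hA h2 h3 v hu

theorem associator_lift_mem (hA : IsAssosymmetric A)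
    (h2 : ∀ a : A, a + a = 0 → a = 0) (h3 : ∀ a : A, a + a + a = 0 → a = 0)
    (u v w : FreeMagma X) :
    associator (FreeMagma.lift g u) (FreeMagma.lift g v) (FreeMagma.lift g w) ∈
      associatorSpan K g (u.content + v.content + w.content) := by
  rw [add_assoc]
  refine associator_lift_left_mem hA h2 h3 (fun x => ?_) u
  rw [hA.swap_left, add_left_comm]
  refine associator_lift_left_mem hA h2 h3 (fun y => ?_) v
  rw [hA.swap_outer, ← add_assoc, add_comm]
  refine associator_lift_left_mem hA h2 h3 (fun z => ?_) w
  exact Submodule.subset_span ⟨[], [z, x, y], by simp, by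
    simp only [← Multiset.cons_coe, Multiset.coe_nil, ← Multiset.singleton_add]; abel, rfl⟩

theorem gen_mul_mem_normalSpan (x : X) {d : Multiset X} {p : A}
    (hp : p ∈ normalSpan K g d) : g x * p ∈ normalSpan K g ({x} + d) := by
  obtain ⟨p, hp', q, hq, rfl⟩ := Submodule.mem_sup.1 hp
  clear hp
  rw [mul_add]
  refine Submodule.add_mem_sup ?_ (gen_mul_mem_associatorSpan x hq)
  induction hp' using Submodule.span_induction with
  | mem p hp =>
    obtain ⟨l, hl, rfl, rfl⟩ := hp
    refine Submodule.subset_span ⟨x :: l, by simp, rfl, ?_⟩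
    match l, hl with
    | _ :: _, _ => rfl
  | zero => rw [mul_zero]; exact zero_mem _
  | add _ _ _ _ h h' => rw [mul_add]; exact add_mem h h'
  | smul r _ _ h => rw [mul_smul_comm]; exact Submodule.smul_mem _ _ h

theorem associator_lift_lift_mem (hA : IsAssosymmetric A)
    (h2 : ∀ a : A, a + a = 0 → a = 0) (h3 : ∀ a : A, a + a + a = 0 → a = 0)
    (u v : FreeMagma X) {d : Multiset X} {p : A} (hp : p ∈ normalSpan K g d) :
    associator (FreeMagma.lift g u) (FreeMagma.lift g v) p ∈
      associatorSpan K g (u.content + v.content + d) := by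
  obtain ⟨p, hp', q, hq, rfl⟩ := Submodule.mem_sup.1 hp
  clear hp
  rw [hA.swap_outer, associator_add_left,
    (isNuclear_of_mem_associatorSpan hA h2 h3 hq).associator_eq_zero, add_zero, ← hA.swap_outer]
  induction hp' using Submodule.span_induction with
  | mem p hp =>
    obtain ⟨l, hl, rfl, rfl⟩ := hp
    obtain ⟨w, hw, hw'⟩ := rightNormed_eq_lift g hl
    rw [← hw, ← hw']
    exact associator_lift_mem hA h2 h3 u v w
  | zero => simp [associator_apply]
  | add _ _ _ _ h h' =>
    rw [hA.swap_outer] at h h' ⊢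
    rw [associator_add_left]
    exact add_mem h h'
  | smul r _ _ h =>
    rw [associator_apply, mul_smul_comm, mul_smul_comm, mul_smul_comm, ← smul_sub]
    exact Submodule.smul_mem _ _ h

/-- Rebracketing `(uv)p` as `u(vp)` costs only the associator `(u, v, p)`, which lies in the
associator span. -/
theorem lift_mul_mem_normalSpan (hA : IsAssosymmetric A)
    (h2 : ∀ a : A, a + a = 0 → a = 0) (h3 : ∀ a : A, a + a + a = 0 → a = 0)
    (u : FreeMagma X) {d : Multiset X} {p : A} (hp : p ∈ normalSpan K g d) :
    FreeMagma.lift g u * p ∈ normalSpan K g (u.content + d) := by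
  induction u generalizing d p with
  | ih1 x => exact gen_mul_mem_normalSpan x hp
  | ih2 u v hu hv =>
    have e : FreeMagma.lift g (u * v) * p = FreeMagma.lift g u * (FreeMagma.lift g v * p)
        + associator (FreeMagma.lift g u) (FreeMagma.lift g v) p := by
      rw [map_mul, associator_apply]; abel
    rw [e]
    refine add_mem ?_ (Submodule.mem_sup_right (associator_lift_lift_mem hA h2 h3 u v hp))
    rw [FreeMagma.content_mul, add_assoc]
    exact hu (hv hp)

theorem lift_mem_normalSpan (hA : IsAssosymmetric A)
    (h2 : ∀ a : A, a + a = 0 → a = 0) (h3 : ∀ a : A, a + a + a = 0 → a = 0)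
    (u : FreeMagma X) : FreeMagma.lift g u ∈ normalSpan K g u.content := by
  induction u with
  | ih1 x => exact Submodule.mem_sup_left (Submodule.subset_span ⟨[x], by simp, rfl, rfl⟩)
  | ih2 u v _ hv =>
    rw [map_mul]
    exact lift_mul_mem_normalSpan hA h2 h3 u hv

end Span

end IsAssosymmetric

/-! ### A model algebra separating the normal elements -/

/-- The underlying space of an assosymmetric algebra that extends the free associative algebra on
`X` by the polynomial ring in two sets of variables `uₓ`, `vₓ` (with zero multiplication). -/
def AssosymmetricModel (K X : Type*) [Field K] : Type _ :=
  MonoidAlgebra K (FreeMonoid X) × MvPolynomial (X ⊕ X) K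

namespace AssosymmetricModel

open MvPolynomial TrivSqZeroExt

variable (K X : Type*) [Field K]

noncomputable instance : AddCommGroup (AssosymmetricModel K X) :=
  inferInstanceAs (AddCommGroup (MonoidAlgebra K (FreeMonoid X) × MvPolynomial (X ⊕ X) K))

noncomputable instance : Module K (AssosymmetricModel K X) :=
  inferInstanceAs (Module K (MonoidAlgebra K (FreeMonoid X) × MvPolynomial (X ⊕ X) K))

/-- The left action: the generator `x` acts as `uₓ`. -/
noncomputable def leftAct : MonoidAlgebra K (FreeMonoid X) →ₐ[K] MvPolynomial (X ⊕ X) K :=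
  MonoidAlgebra.lift K _ _ (FreeMonoid.lift fun x => MvPolynomial.X (Sum.inl x))

/-- The right action: the generator `x` acts as `uₓ + vₓ`. -/
noncomputable def rightAct : MonoidAlgebra K (FreeMonoid X) →ₐ[K] MvPolynomial (X ⊕ X) K :=
  MonoidAlgebra.lift K _ _ (FreeMonoid.lift fun x =>
    MvPolynomial.X (Sum.inl x) + MvPolynomial.X (Sum.inr x))

/-- The first-order Taylor expansion of the right action around the left action. -/
noncomputable def taylor :
    MonoidAlgebra K (FreeMonoid X) →ₐ[K] DualNumber (MvPolynomial (X ⊕ X) K) :=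
  MonoidAlgebra.lift K _ _ (FreeMonoid.lift fun x =>
    inl (MvPolynomial.X (Sum.inl x)) + inr (MvPolynomial.X (Sum.inr x)))

/-- The derivation over the left action that sends the generator `x` to `vₓ`. -/
noncomputable def deriv : MonoidAlgebra K (FreeMonoid X) →ₗ[K] MvPolynomial (X ⊕ X) K :=
  (sndHom (MvPolynomial (X ⊕ X) K) (MvPolynomial (X ⊕ X) K)).restrictScalars K ∘ₗ
    (taylor K X).toLinearMap

/-- The difference of the right and the left action. -/
noncomputable def diff : MonoidAlgebra K (FreeMonoid X) →ₗ[K] MvPolynomial (X ⊕ X) K :=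
  (rightAct K X).toLinearMap - (leftAct K X).toLinearMap

/-- The second-order Taylor remainder of the right action. -/
noncomputable def remainder : MonoidAlgebra K (FreeMonoid X) →ₗ[K] MvPolynomial (X ⊕ X) K :=
  diff K X - deriv K X

variable {K X}

theorem leftAct_of (x : X) : leftAct K X (MonoidAlgebra.of K _ (FreeMonoid.of x)) =
    MvPolynomial.X (Sum.inl x) := by
  rw [leftAct, MonoidAlgebra.lift_of, FreeMonoid.lift_eval_of]

theorem rightAct_of (x : X) : rightAct K X (MonoidAlgebra.of K _ (FreeMonoid.of x)) =
    MvPolynomial.X (Sum.inl x) + MvPolynomial.X (Sum.inr x) := by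
  rw [rightAct, MonoidAlgebra.lift_of, FreeMonoid.lift_eval_of]

theorem fst_taylor (a : MonoidAlgebra K (FreeMonoid X)) : (taylor K X a).fst = leftAct K X a := by
  have : (fstHom K (MvPolynomial (X ⊕ X) K) (MvPolynomial (X ⊕ X) K)).comp (taylor K X) =
      leftAct K X := by
    refine (MonoidAlgebra.lift K _ _).symm.injective (FreeMonoid.hom_eq fun x => ?_)
    change (taylor K X (MonoidAlgebra.of K _ (FreeMonoid.of x))).fst =
      leftAct K X (MonoidAlgebra.of K _ (FreeMonoid.of x))
    rw [leftAct_of, taylor, MonoidAlgebra.lift_of, FreeMonoid.lift_eval_of]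
    simp
  exact DFunLike.congr_fun this a

theorem deriv_of (x : X) : deriv K X (MonoidAlgebra.of K _ (FreeMonoid.of x)) =
    MvPolynomial.X (Sum.inr x) := by
  change (taylor K X (MonoidAlgebra.of K _ (FreeMonoid.of x))).snd = _
  rw [taylor, MonoidAlgebra.lift_of, FreeMonoid.lift_eval_of]
  simp

theorem deriv_mul (a b : MonoidAlgebra K (FreeMonoid X)) :
    deriv K X (a * b) = leftAct K X a * deriv K X b + deriv K X a * leftAct K X b := by
  change (taylor K X (a * b)).snd = _
  rw [map_mul, DualNumber.snd_mul, fst_taylor, fst_taylor]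
  rfl

theorem diff_apply (a : MonoidAlgebra K (FreeMonoid X)) :
    diff K X a = rightAct K X a - leftAct K X a := rfl

theorem diff_of (x : X) : diff K X (MonoidAlgebra.of K _ (FreeMonoid.of x)) =
    MvPolynomial.X (Sum.inr x) := by
  rw [diff_apply, leftAct_of, rightAct_of, add_sub_cancel_left]

theorem remainder_apply (a : MonoidAlgebra K (FreeMonoid X)) :
    remainder K X a = rightAct K X a - leftAct K X a - deriv K X a := rfl

theorem remainder_of (x : X) : remainder K X (MonoidAlgebra.of K _ (FreeMonoid.of x)) = 0 := by
  rw [remainder_apply, leftAct_of, rightAct_of, deriv_of, add_sub_cancel_left, sub_self]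

/-- The last term is a 2-cochain whose coboundary is `diff a * diff b * diff c`, which is visibly
symmetric. Since `remainder` vanishes on generators, right-normed words acquire no polynomial part.
-/
noncomputable instance : Mul (AssosymmetricModel K X) where
  mul p q := (p.1 * q.1,
    leftAct K X p.1 * q.2 + rightAct K X q.1 * p.2 + remainder K X p.1 * diff K X q.1)

theorem fst_mul (p q : AssosymmetricModel K X) : (p * q).1 = p.1 * q.1 := rfl

theorem snd_mul (p q : AssosymmetricModel K X) : (p * q).2 =
    leftAct K X p.1 * q.2 + rightAct K X q.1 * p.2 + remainder K X p.1 * diff K X q.1 := rfl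

theorem fst_add (p q : AssosymmetricModel K X) : (p + q).1 = p.1 + q.1 := rfl
theorem snd_add (p q : AssosymmetricModel K X) : (p + q).2 = p.2 + q.2 := rfl
theorem fst_sub (p q : AssosymmetricModel K X) : (p - q).1 = p.1 - q.1 := rfl
theorem snd_sub (p q : AssosymmetricModel K X) : (p - q).2 = p.2 - q.2 := rfl
theorem fst_smul (c : K) (p : AssosymmetricModel K X) : (c • p).1 = c • p.1 := rfl
theorem snd_smul (c : K) (p : AssosymmetricModel K X) : (c • p).2 = c • p.2 := rfl
theorem fst_zero : (0 : AssosymmetricModel K X).1 = 0 := rfl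
theorem snd_zero : (0 : AssosymmetricModel K X).2 = 0 := rfl

theorem ext_iff' {p q : AssosymmetricModel K X} : p = q ↔ p.1 = q.1 ∧ p.2 = q.2 := Prod.ext_iff

noncomputable instance : NonUnitalNonAssocRing (AssosymmetricModel K X) where
  left_distrib a b c := by
    simp only [ext_iff', fst_mul, snd_mul, fst_add, snd_add, map_add, mul_add, true_and]
    ring
  right_distrib a b c := by
    simp only [ext_iff', fst_mul, snd_mul, fst_add, snd_add, map_add, add_mul, true_and]
    ring
  zero_mul a := by
    simp only [ext_iff', fst_mul, snd_mul, fst_zero, snd_zero, map_zero, zero_mul, mul_zero,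
      add_zero, and_self]
  mul_zero a := by
    simp only [ext_iff', fst_mul, snd_mul, fst_zero, snd_zero, map_zero, zero_mul, mul_zero,
      add_zero, and_self]

instance : IsScalarTower K (AssosymmetricModel K X) (AssosymmetricModel K X) where
  smul_assoc c a b := by
    simp only [smul_eq_mul, ext_iff', fst_mul, snd_mul, fst_smul, snd_smul, map_smul,
      smul_mul_assoc, mul_smul_comm, smul_add, and_self]

instance : SMulCommClass K (AssosymmetricModel K X) (AssosymmetricModel K X) where
  smul_comm c a b := by
    simp only [smul_eq_mul, ext_iff', fst_mul, snd_mul, fst_smul, snd_smul, map_smul,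
      smul_mul_assoc, mul_smul_comm, smul_add, and_self]

/-- The element of the model with the given components. -/
def mk (a : MonoidAlgebra K (FreeMonoid X)) (m : MvPolynomial (X ⊕ X) K) :
    AssosymmetricModel K X := (a, m)

theorem fst_mk (a : MonoidAlgebra K (FreeMonoid X)) (m : MvPolynomial (X ⊕ X) K) :
    (mk a m).1 = a := rfl

theorem snd_mk (a : MonoidAlgebra K (FreeMonoid X)) (m : MvPolynomial (X ⊕ X) K) :
    (mk a m).2 = m := rfl

/-- With `L`, `δ`, `ρ` for `leftAct`, `diff`, `remainder`, the computation rests on `ρ(ab) =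
L(a)ρ(b) + ρ(a)L(b) + δ(a)δ(b)`. The twisted rule for `δ(bc)` cancels all but `δ(a)δ(b)δ(c)`. -/
theorem associator_eq (a b c : AssosymmetricModel K X) :
    associator a b c = mk 0 (diff K X a.1 * diff K X b.1 * diff K X c.1) := by
  rw [associator_apply]
  refine ext_iff'.2 ⟨?_, ?_⟩
  · rw [fst_sub, fst_mul, fst_mul, fst_mul, fst_mul, mul_assoc, sub_self, fst_mk]
  · rw [snd_sub, snd_mul, snd_mul, snd_mul, snd_mul, fst_mul, fst_mul, snd_mk]
    simp only [remainder_apply, diff_apply, deriv_mul, map_mul]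
    ring

theorem isAssosymmetric : IsAssosymmetric (AssosymmetricModel K X) := by
  intro a b c
  rw [associator_eq, associator_eq, associator_eq]
  exact ⟨by rw [mul_right_comm], by rw [mul_comm (diff K X a.1)]⟩

variable (K) in
/-- The generators of the model. -/
noncomputable def gen (x : X) : AssosymmetricModel K X :=
  mk (MonoidAlgebra.of K _ (FreeMonoid.of x)) 0

theorem fst_gen (x : X) : (gen K x).1 = MonoidAlgebra.of K _ (FreeMonoid.of x) := rfl

theorem snd_gen (x : X) : (gen K x).2 = 0 := rfl

theorem gen_mul_mk (x : X) (a : MonoidAlgebra K (FreeMonoid X)) (m : MvPolynomial (X ⊕ X) K) :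
    gen K x * mk a m = mk (MonoidAlgebra.of K _ (FreeMonoid.of x) * a)
      (MvPolynomial.X (Sum.inl x) * m) := by
  refine ext_iff'.2 ⟨?_, ?_⟩
  · rw [fst_mul, fst_gen, fst_mk, fst_mk]
  · rw [snd_mul, fst_gen, snd_gen, fst_mk, snd_mk, snd_mk, leftAct_of, remainder_of, mul_zero,
      zero_mul, add_zero, add_zero]

theorem mk_zero_mul_gen (x : X) (m : MvPolynomial (X ⊕ X) K) :
    mk 0 m * gen K x =
      mk 0 ((MvPolynomial.X (Sum.inl x) + MvPolynomial.X (Sum.inr x)) * m) := by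
  refine ext_iff'.2 ⟨?_, ?_⟩
  · rw [fst_mul, fst_mk, fst_mk, zero_mul]
  · rw [snd_mul, fst_gen, snd_gen, fst_mk, snd_mk, snd_mk, rightAct_of, map_zero, map_zero,
      mul_zero, zero_mul, add_zero, zero_add]

theorem rightNormed_gen : ∀ {l : List X}, l ≠ [] →
    IsAssosymmetric.rightNormed (gen K) l = mk (MonoidAlgebra.of K _ (FreeMonoid.ofList l)) 0
  | [x], _ => rfl
  | x :: y :: t, _ => by
    rw [IsAssosymmetric.rightNormed, rightNormed_gen (by simp), gen_mul_mk, mul_zero, ← map_mul,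
      ← FreeMonoid.ofList_cons]

/-- On the polynomial part, commutation with the generator `x` is right minus left action, that is,
multiplication by `vₓ`. -/
theorem associatorTower_gen : ∀ {b : List X}, 3 ≤ b.length →
    IsAssosymmetric.associatorTower (gen K) b =
      mk 0 (b.map fun x => MvPolynomial.X (Sum.inr x)).prod
  | [x, y, z], _ => by
    rw [IsAssosymmetric.associatorTower, associator_eq, fst_gen, fst_gen, fst_gen]
    simp only [diff_of, List.map_cons, List.map_nil, List.prod_cons, List.prod_nil, mul_one,
      mul_assoc]
  | w :: x :: y :: z :: t, _ => by
    rw [IsAssosymmetric.associatorTower, associatorTower_gen (by simp), gen_mul_mk,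
      mk_zero_mul_gen, mul_zero]
    refine ext_iff'.2 ⟨?_, ?_⟩
    · rw [fst_sub, fst_mk, fst_mk, fst_mk, sub_zero]
    · rw [snd_sub, snd_mk, snd_mk, snd_mk, List.map_cons (a := w), List.prod_cons]
      ring

theorem associatorNormal_gen {b : List X} (hb : 3 ≤ b.length) : ∀ a : List X,
    IsAssosymmetric.associatorNormal (gen K) a b =
      mk 0 ((a.map fun x => MvPolynomial.X (Sum.inl x)).prod *
        (b.map fun x => MvPolynomial.X (Sum.inr x)).prod)
  | [] => by
    rw [List.map_nil, List.prod_nil, one_mul]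
    exact associatorTower_gen hb
  | x :: a => by
    rw [IsAssosymmetric.associatorNormal_cons, associatorNormal_gen hb a, gen_mul_mk, mul_zero,
      List.map_cons, List.prod_cons, mul_assoc]

end AssosymmetricModel

/-! ### Monomials in two sets of variables as pairs of multisets -/

theorem Multiset.filterMap_const_none {X Y : Type*} (s : Multiset X) :
    s.filterMap (fun _ => (none : Option Y)) = 0 := by
  induction s using Multiset.induction_on with
  | empty => rfl
  | cons x s ih => rw [Multiset.filterMap_cons_none _ _ rfl, ih]

/-- Multisets on a disjoint union are pairs of multisets. -/
def Multiset.disjSumEquiv (X Y : Type*) : Multiset X × Multiset Y ≃ Multiset (X ⊕ Y) where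
  toFun p := p.1.disjSum p.2
  invFun s := (s.filterMap Sum.getLeft?, s.filterMap Sum.getRight?)
  left_inv p := by
    ext1 <;> simp only [Multiset.disjSum, Multiset.filterMap_add, Multiset.filterMap_map] <;>
      simp [Function.comp_def, Multiset.filterMap_const_none]
  right_inv s := by
    induction s using Multiset.induction_on with
    | empty => rfl
    | cons x s ih =>
      simp only [Multiset.disjSum] at ih ⊢
      rcases x with x | x
      · rw [Multiset.filterMap_cons_some Sum.getLeft? _ _ rfl, Multiset.filterMap_cons_none _ _ rfl,
          Multiset.map_cons, Multiset.cons_add, ih]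
      · rw [Multiset.filterMap_cons_some Sum.getRight? _ _ rfl,
          Multiset.filterMap_cons_none _ _ rfl, Multiset.map_cons, Multiset.add_cons, ih]

namespace MvPolynomial

theorem prod_map_X_list {σ R : Type*} [CommSemiring R] [DecidableEq σ] (l : List σ) :
    (l.map (X : σ → MvPolynomial σ R)).prod = monomial (Multiset.toFinsupp (l : Multiset σ)) 1 := by
  induction l with
  | nil => simp
  | cons x l ih =>
    rw [List.map_cons, List.prod_cons, ih, ← Multiset.cons_coe, ← Multiset.singleton_add,
      map_add, Multiset.toFinsupp_singleton, monomial_single_add, pow_one]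

end MvPolynomial

/-! ### The normal elements form a basis -/

namespace IsAssosymmetric

section Naturality

variable {A B X F : Type*} [NonUnitalNonAssocRing A] [NonUnitalNonAssocRing B]
  [FunLike F A B] [NonUnitalRingHomClass F A B] (φ : F) (g : X → A)

theorem map_rightNormed : ∀ l : List X, φ (rightNormed g l) = rightNormed (φ ∘ g) l
  | [] => map_zero φ
  | [_] => rfl
  | x :: y :: t => by
    rw [rightNormed, map_mul, map_rightNormed (y :: t)]; rfl

theorem map_associatorTower : ∀ b : List X, φ (associatorTower g b) = associatorTower (φ ∘ g) b
  | [] => map_zero φ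
  | [_] => map_zero φ
  | [_, _] => map_zero φ
  | [x, y, z] => by
    simp only [associatorTower, associator_apply, map_sub, map_mul, Function.comp_apply]
  | w :: x :: y :: z :: t => by
    simp only [associatorTower, map_sub, map_mul, map_associatorTower (x :: y :: z :: t),
      Function.comp_apply]

theorem map_associatorNormal (b : List X) :
    ∀ a : List X, φ (associatorNormal g a b) = associatorNormal (φ ∘ g) a b
  | [] => map_associatorTower φ g b
  | x :: a => by
    rw [associatorNormal_cons, map_mul, map_associatorNormal b a]; rfl

end Naturality

/-- The index set of the normal elements: the nonempty lists of generators, and the pairs of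
multisets of generators of which the second has at least three elements. -/
abbrev NormalIndex (X : Type*) : Type _ :=
  {l : List X // l ≠ []} ⊕ {p : Multiset X × Multiset X // 3 ≤ Multiset.card p.2}

/-- The content of a normal element. -/
def NormalIndex.content {X : Type*} : NormalIndex X → Multiset X :=
  Sum.elim (fun l => ↑l.1) (fun p => p.1.1 + p.1.2)

/-- The normal elements. -/
noncomputable def normalElement {A X : Type*} [NonUnitalNonAssocRing A] (g : X → A) :
    NormalIndex X → A :=
  Sum.elim (fun l => rightNormed g l.1) (fun p => associatorNormal g p.1.1.toList p.1.2.toList)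

section Span

variable {K A X : Type*} [Field K] [NonUnitalNonAssocRing A] [Module K A]
  [IsScalarTower K A A] [SMulCommClass K A A] {g : X → A}

theorem normalElement_mem_wordSpan (i : NormalIndex X) :
    normalElement g i ∈ wordSpan K g i.content := by
  rcases i with l | p
  · exact rightNormed_mem_wordSpan l.2
  · have h := associatorNormal_mem_wordSpan (K := K) (g := g) p.1.2.toList p.1.1.toList
    rwa [Multiset.coe_toList, Multiset.coe_toList] at h

theorem normalSpan_le (hA : IsAssosymmetric A)
    (h2 : ∀ a : A, a + a = 0 → a = 0) (h3 : ∀ a : A, a + a + a = 0 → a = 0) (d : Multiset X) :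
    normalSpan K g d ≤ Submodule.span K (normalElement g '' {i | i.content = d}) := by
  refine sup_le ?_ ?_
  · refine Submodule.span_mono ?_
    rintro _ ⟨l, hl, rfl, rfl⟩
    exact ⟨Sum.inl ⟨l, hl⟩, rfl, rfl⟩
  · refine Submodule.span_mono ?_
    rintro _ ⟨a, b, hb, rfl, rfl⟩
    refine ⟨Sum.inr ⟨(↑a, ↑b), hb⟩, rfl, ?_⟩
    exact associatorNormal_perm hA h2 h3 (Multiset.coe_eq_coe.1 (Multiset.coe_toList _))
      (Multiset.coe_eq_coe.1 (Multiset.coe_toList _))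

/-- A set `S` of contents covers both gradings: a singleton gives a multidegree, the multisets of
cardinality `n` give a degree. -/
theorem span_words_eq_span_normalElement (hA : IsAssosymmetric A)
    (h2 : ∀ a : A, a + a = 0 → a = 0) (h3 : ∀ a : A, a + a + a = 0 → a = 0)
    (S : Set (Multiset X)) :
    Submodule.span K {p | ∃ w : FreeMagma X, w.content ∈ S ∧ FreeMagma.lift g w = p} =
      Submodule.span K (normalElement g '' {i | i.content ∈ S}) := by
  refine le_antisymm (Submodule.span_le.2 ?_) (Submodule.span_le.2 ?_)
  · rintro _ ⟨w, hw, rfl⟩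
    refine Submodule.span_mono (Set.image_mono fun i hi => ?_)
      (normalSpan_le hA h2 h3 _ (lift_mem_normalSpan hA h2 h3 w))
    exact (congrArg (· ∈ S) hi).mpr hw
  · rintro _ ⟨i, hi, rfl⟩
    refine Submodule.span_mono ?_ (normalElement_mem_wordSpan i)
    rintro _ ⟨w, hw, rfl⟩
    exact ⟨w, hw ▸ hi, rfl⟩

end Span

end IsAssosymmetric

namespace AssosymmetricModel

variable {K X : Type*} [Field K]

open IsAssosymmetric

theorem linearIndependent_normalElement :
    LinearIndependent K (normalElement (gen K (X := X))) := by
  classical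
  have h1 : LinearIndependent K fun l : {l : List X // l ≠ []} =>
      MonoidAlgebra.of K _ (FreeMonoid.ofList l.1) :=
    (MonoidAlgebra.basis (FreeMonoid X) K).linearIndependent.comp
      (fun l : {l : List X // l ≠ []} => FreeMonoid.ofList l.1)
      (FreeMonoid.ofList.injective.comp Subtype.val_injective)
  have h2 : LinearIndependent K fun p : {p : Multiset X × Multiset X // 3 ≤ Multiset.card p.2} =>
      (MvPolynomial.monomial (Multiset.toFinsupp (Multiset.disjSumEquiv X X p.1)) (1 : K)) :=
    (MvPolynomial.basisMonomials (X ⊕ X) K).linearIndependent.comp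
      (fun p : {p : Multiset X × Multiset X // 3 ≤ Multiset.card p.2} =>
        Multiset.toFinsupp (Multiset.disjSumEquiv X X p.1))
      (Multiset.toFinsupp.injective.comp
        ((Multiset.disjSumEquiv X X).injective.comp Subtype.val_injective))
  have h := linearIndependent_inl_union_inr' h1 h2
  refine (linearIndependent_equiv' (M := AssosymmetricModel K X) (Equiv.refl _) ?_).1 h
  funext i
  rcases i with l | p
  · exact rightNormed_gen l.2
  · refine (associatorNormal_gen (by rw [Multiset.length_toList]; exact p.2) _).trans ?_
    refine Prod.ext rfl ?_
    change _ * _ = MvPolynomial.monomial _ 1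
    rw [show (fun x : X => (MvPolynomial.X (Sum.inl x) : MvPolynomial (X ⊕ X) K)) =
      MvPolynomial.X ∘ Sum.inl from rfl,
      show (fun x : X => (MvPolynomial.X (Sum.inr x) : MvPolynomial (X ⊕ X) K)) =
      MvPolynomial.X ∘ Sum.inr from rfl, ← List.map_map, ← List.map_map, ← List.prod_append,
      ← List.map_append, MvPolynomial.prod_map_X_list, ← Multiset.coe_add, ← Multiset.map_coe,
      ← Multiset.map_coe, Multiset.coe_toList, Multiset.coe_toList]
    rfl

end AssosymmetricModel

namespace FreeAssosymmetric

open IsAssosymmetric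

variable {K X : Type*} [Field K]

/-- The universal property maps normal elements of the free algebra to those of the model, and a
family with independent image is independent. -/
theorem linearIndependent_normalElement :
    LinearIndependent K (normalElement (gen K (X := X))) := by
  obtain ⟨φ, hφ, -⟩ := existsUnique_lift (K := K) (X := X)
    (AssosymmetricModel.isAssosymmetric (K := K) (X := X)) (AssosymmetricModel.gen K)
  have hg : φ ∘ gen K = AssosymmetricModel.gen K := funext hφ
  let ψ : FreeAssosymmetric K X →ₗ[K] AssosymmetricModel K X :=
    { toFun := φ, map_add' := map_add φ, map_smul' := map_smul φ }
  refine LinearIndependent.of_comp ψ ?_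
  have e : ψ ∘ normalElement (gen K (X := X)) = normalElement (AssosymmetricModel.gen K) := by
    funext i
    rcases i with l | p
    · exact (map_rightNormed φ (gen K) l.1).trans (by rw [hg]; rfl)
    · exact (map_associatorNormal φ (gen K) p.1.2.toList p.1.1.toList).trans (by rw [hg]; rfl)
  rw [e]
  exact AssosymmetricModel.linearIndependent_normalElement

theorem finrank_span_words (h2 : ringChar K ≠ 2) (h3 : ringChar K ≠ 3) (S : Set (Multiset X))
    [Finite {i : NormalIndex X // i.content ∈ S}] {W : Submodule K (FreeAssosymmetric K X)}
    (hW : W = Submodule.span K {p | ∃ w : FreeMagma X, w.content ∈ S ∧ word K w = p}) :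
    Module.Finite K W ∧ Module.finrank K W = Nat.card {i : NormalIndex X // i.content ∈ S} := by
  have h2' : (2 : K) ≠ 0 := Ring.two_ne_zero h2
  have h3' : (3 : K) ≠ 0 := by
    intro h
    have h' : ringChar K ∣ 3 := (ringChar.spec K 3).1 (by exact_mod_cast h)
    rcases (Nat.dvd_prime Nat.prime_three).1 h' with h1 | h1
    · exact absurd h1 (CharP.ringChar_ne_one)
    · exact h3 h1
  have t2 : ∀ a : FreeAssosymmetric K X, a + a = 0 → a = 0 := by
    intro a ha
    rw [← two_smul K] at ha
    exact (smul_eq_zero.1 ha).resolve_left h2'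
  have t3 : ∀ a : FreeAssosymmetric K X, a + a + a = 0 → a = 0 := by
    intro a ha
    have e : (3 : K) • a = a + a + a := by module
    exact (smul_eq_zero.1 (e.trans ha)).resolve_left h3'
  have : Finite ↑{i : NormalIndex X | i.content ∈ S} := ‹_›
  have := Fintype.ofFinite {i : NormalIndex X // i.content ∈ S}
  have hs := span_words_eq_span_normalElement (K := K) (g := gen K) (isAssosymmetric K X) t2 t3 S
  rw [Set.image_eq_range] at hs
  have hli := (linearIndependent_normalElement (K := K) (X := X)).comp
    (Subtype.val : {i : NormalIndex X // i.content ∈ S} → NormalIndex X) Subtype.val_injective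
  have hf := finrank_span_eq_card hli
  obtain rfl := hW.trans hs
  rw [Nat.card_eq_fintype_card]
  exact ⟨Module.Finite.span_of_finite K (Set.finite_range _), hf⟩

end FreeAssosymmetric

/-! ### Counting the normal elements -/

theorem Nat.card_eq_card_three_le_add {Z : Type*} [Finite Z] (f : Z → ℕ) :
    Nat.card Z = Nat.card {z // 3 ≤ f z} + Nat.card {z // f z = 0} + Nat.card {z // f z = 1} +
      Nat.card {z // f z = 2} := by
  classical
  have := Fintype.ofFinite Z
  simp only [Nat.card_eq_fintype_card, Fintype.card_subtype, Finset.card_filter,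
    ← Finset.sum_add_distrib]
  rw [Fintype.card_eq_sum_ones]
  refine Finset.sum_congr rfl fun z _ => ?_
  rcases Nat.lt_or_ge (f z) 3 with h | h
  · interval_cases f z <;> simp
  · simp [h, show f z ≠ 0 by omega, show f z ≠ 1 by omega, show f z ≠ 2 by omega]

/-- Both sides are the coefficient of the monomial of `m` in `(∑ x, X x) ^ n`, expanded once over
functions `Fin n → X` and once by the multinomial theorem. -/
theorem Multiset.card_lists_eq_multinomial {X : Type*} [Fintype X] [DecidableEq X]
    (m : Multiset X) :
    Nat.card {l : List X // (l : Multiset X) = m} =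
      Nat.multinomial Finset.univ (fun x => m.count x) := by
  set n := Multiset.card m with hn
  have hl : ∀ l : {l : List X // (l : Multiset X) = m}, n = l.1.length :=
    fun l => (congrArg Multiset.card l.2).symm
  have e : {l : List X // (l : Multiset X) = m} ≃
      {v : Fin n → X // (↑(List.ofFn v) : Multiset X) = m} :=
    { toFun l := ⟨fun i => l.1.get (i.cast (hl l)), by
        refine Eq.trans (congrArg _ ?_) l.2
        apply List.ext_get
        · rw [List.length_ofFn, hl l]
        · intro i h1 h2
          simp⟩
      invFun v := ⟨List.ofFn v.1, v.2⟩
      left_inv l := by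
        ext1
        apply List.ext_get
        · rw [List.length_ofFn, hl l]
        · intro i h1 h2
          simp
      right_inv v := by
        ext1
        funext i
        simp }
  rw [Nat.card_congr e, Nat.card_eq_fintype_card, Fintype.card_subtype]
  have h1 : (∑ x : X, (MvPolynomial.X x : MvPolynomial X ℕ)) ^ n =
      ∑ v : Fin n → X,
        MvPolynomial.monomial (Multiset.toFinsupp (↑(List.ofFn v) : Multiset X)) 1 := by
    rw [Fintype.sum_pow]
    refine Finset.sum_congr rfl fun v _ => ?_
    rw [← MvPolynomial.prod_map_X_list, List.map_ofFn, List.prod_ofFn]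
    rfl
  have h2 := congrArg (MvPolynomial.coeff (Multiset.toFinsupp m)) h1
  rw [Finset.sum_pow_eq_sum_piAntidiag, MvPolynomial.coeff_sum, MvPolynomial.coeff_sum] at h2
  simp only [MvPolynomial.coeff_monomial, EmbeddingLike.apply_eq_iff_eq] at h2
  rw [Finset.card_filter, ← h2]
  have h3 : ∀ k : X → ℕ, MvPolynomial.coeff (Multiset.toFinsupp m)
      ((Nat.multinomial Finset.univ k : MvPolynomial X ℕ) * ∏ x, MvPolynomial.X x ^ k x) =
      if k = fun x => m.count x then Nat.multinomial Finset.univ k else 0 := by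
    intro k
    have : (∏ x, MvPolynomial.X x ^ k x : MvPolynomial X ℕ) =
        MvPolynomial.monomial (Finsupp.equivFunOnFinite.symm k) 1 := by
      rw [MvPolynomial.monomial_eq, Finsupp.prod_fintype _ _ (fun _ => pow_zero _)]
      simp
    rw [this, ← map_natCast (MvPolynomial.C), MvPolynomial.coeff_C_mul,
      MvPolynomial.coeff_monomial]
    have hk : (Finsupp.equivFunOnFinite.symm k = Multiset.toFinsupp m) ↔
        k = fun x => m.count x := by
      rw [Equiv.symm_apply_eq]; rfl
    simp only [hk, mul_ite, mul_one, mul_zero, Nat.cast_id]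
  simp only [h3]
  rw [Finset.sum_ite_eq_of_mem']
  rw [Finset.mem_piAntidiag]
  refine ⟨?_, fun _ _ => Finset.mem_univ _⟩
  rw [Multiset.sum_count_eq_card (fun a _ => Finset.mem_univ a)]

namespace IsAssosymmetric

theorem card_normalIndex {X : Type*} (S : Set (Multiset X))
    [Finite {i : NormalIndex X // i.content ∈ S}] (h0 : 0 ∉ S) :
    Nat.card {i : NormalIndex X // i.content ∈ S} =
      Nat.card {l : List X // (l : Multiset X) ∈ S} +
      Nat.card {q : {p : Multiset X × Multiset X // p.1 + p.2 ∈ S} //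
        3 ≤ Multiset.card q.1.2} := by
  have e := Equiv.subtypeSum (p := fun i : NormalIndex X => i.content ∈ S)
  have : Finite _ := Finite.of_equiv _ e
  have := Finite.sum_left (α := {a : {l : List X // l ≠ []} // NormalIndex.content (Sum.inl a) ∈ S})
    {b : {p : Multiset X × Multiset X // 3 ≤ Multiset.card p.2} //
      NormalIndex.content (Sum.inr b) ∈ S}
  have := Finite.sum_right (β := {b : {p : Multiset X × Multiset X // 3 ≤ Multiset.card p.2} //
      NormalIndex.content (Sum.inr b) ∈ S})
    {a : {l : List X // l ≠ []} // NormalIndex.content (Sum.inl a) ∈ S}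
  rw [Nat.card_congr e, Nat.card_sum]
  congr 1
  · refine Nat.card_congr (Equiv.subtypeSubtypeEquivSubtype (p := fun l : List X => l ≠ [])
      (q := fun l : List X => (l : Multiset X) ∈ S) ?_)
    rintro l hl rfl
    exact h0 hl
  · let P := fun p : Multiset X × Multiset X => 3 ≤ Multiset.card p.2
    let Q := fun p : Multiset X × Multiset X => p.1 + p.2 ∈ S
    exact Nat.card_congr ((Equiv.subtypeSubtypeEquivSubtypeInter P Q).trans
      ((Equiv.subtypeEquivRight fun _ => and_comm).trans
        (Equiv.subtypeSubtypeEquivSubtypeInter Q P).symm))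

/-- Pairs of multisets with `n` elements in total are multisets on the disjoint union. -/
def pairsEquivSym (X Y : Type*) (n : ℕ) :
    {p : Multiset X × Multiset Y // Multiset.card p.1 + Multiset.card p.2 = n} ≃ Sym (X ⊕ Y) n :=
  (Multiset.disjSumEquiv X Y).subtypeEquiv fun p => by
    rw [← Multiset.card_disjSum]; rfl

theorem finite_normalIndex {X : Type*} [Finite X] (n : ℕ) {S : Set (Multiset X)}
    (hS : ∀ m ∈ S, Multiset.card m = n) : Finite {i : NormalIndex X // i.content ∈ S} := by
  classical
  have := Fintype.ofFinite X
  have : Finite {p : Multiset X × Multiset X // Multiset.card p.1 + Multiset.card p.2 = n} :=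
    Finite.of_equiv _ (pairsEquivSym X X n).symm
  have : Finite {l : List X // l.length = n} := List.finite_length_eq X n
  refine Finite.of_injective (β := {l : List X // l.length = n} ⊕
    {p : Multiset X × Multiset X // Multiset.card p.1 + Multiset.card p.2 = n})
    (fun i => match i with
      | ⟨Sum.inl l, h⟩ => Sum.inl ⟨l.1, hS _ h⟩
      | ⟨Sum.inr p, h⟩ => Sum.inr ⟨p.1, (Multiset.card_add _ _).symm.trans (hS _ h)⟩) ?_
  rintro ⟨l | p, h⟩ ⟨l' | p', h'⟩ e
  · simp only [Sum.inl.injEq, Subtype.ext_iff] at e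
    simp only [Sum.inl.injEq, Subtype.ext_iff]
    exact e
  · simp at e
  · simp at e
  · simp only [Sum.inr.injEq, Subtype.ext_iff] at e
    simp only [Sum.inr.injEq, Subtype.ext_iff]
    exact e

section Degree

variable {X : Type*} [Fintype X]

theorem card_pairs_fiber (n k : ℕ) :
    Nat.card {q : {p : Multiset X × Multiset X // Multiset.card p.1 + Multiset.card p.2 = n + k} //
      Multiset.card q.1.2 = k} =
      (Fintype.card X + n - 1).choose n * (Fintype.card X + k - 1).choose k := by
  classical
  rw [← Sym.card_sym_eq_choose, ← Sym.card_sym_eq_choose, ← Fintype.card_prod,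
    ← Nat.card_eq_fintype_card]
  exact Nat.card_congr
    { toFun q := (⟨q.1.1.1, by have := q.1.2; have := q.2; omega⟩, ⟨q.1.1.2, q.2⟩)
      invFun s := ⟨⟨(s.1.1, s.2.1), by rw [s.1.2, s.2.2]⟩, s.2.2⟩
      left_inv _ := rfl
      right_inv _ := rfl }

theorem card_pairs_degree {n : ℕ} (hn : 1 ≤ n) :
    (Nat.card {q : {p : Multiset X × Multiset X // Multiset.card p.1 + Multiset.card p.2 = n} //
      3 ≤ Multiset.card q.1.2} : ℤ) =
      ((n + 2 * Fintype.card X - 1).choose n : ℤ)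
          - ((Fintype.card X + 1).choose 2 : ℤ) *
            (if n = 1 then 0 else ((n + Fintype.card X - 3).choose (n - 2) : ℤ))
          - (Fintype.card X : ℤ) * ((n + Fintype.card X - 2).choose (n - 1) : ℤ)
          - ((n + Fintype.card X - 1).choose n : ℤ) := by
  classical
  have : Finite {p : Multiset X × Multiset X // Multiset.card p.1 + Multiset.card p.2 = n} :=
    Finite.of_equiv _ (pairsEquivSym X X n).symm
  have h := Nat.card_eq_card_three_le_add (fun q :
    {p : Multiset X × Multiset X // Multiset.card p.1 + Multiset.card p.2 = n} =>
    Multiset.card q.1.2)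
  rw [Nat.card_congr (pairsEquivSym X X n), Nat.card_eq_fintype_card, Sym.card_sym_eq_choose,
    Fintype.card_sum] at h
  have h0 := card_pairs_fiber (X := X) n 0
  obtain ⟨m, rfl⟩ : ∃ m, n = m + 1 := ⟨n - 1, by omega⟩
  have h1 := card_pairs_fiber (X := X) m 1
  have h2 : Nat.card {q : {p : Multiset X × Multiset X //
      Multiset.card p.1 + Multiset.card p.2 = m + 1} // Multiset.card q.1.2 = 2} =
      (Fintype.card X + 1).choose 2 *
        (if m + 1 = 1 then 0 else ((m + 1 + Fintype.card X - 3).choose (m + 1 - 2))) := by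
    rcases m with _ | m
    -- In degree 1 no pair has two letters in its second part. The `if` is essential: truncated
    -- subtraction would turn the binomial into `choose _ 0 = 1`.
    · rw [if_pos rfl, mul_zero]
      refine Nat.card_eq_zero.2 (Or.inl ⟨fun q => ?_⟩)
      have := q.1.2
      have := q.2
      omega
    · rw [if_neg (by omega), card_pairs_fiber (X := X) m 2, mul_comm]
      congr 2
      omega
  have e1 : Fintype.card X + (m + 1) - 1 = m + 1 + Fintype.card X - 1 := by omega
  have e2 : Fintype.card X + m - 1 = m + 1 + Fintype.card X - 2 := by omega
  have e3 : Fintype.card X + Fintype.card X + (m + 1) - 1 = m + 1 + 2 * Fintype.card X - 1 := by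
    omega
  have e4 : Fintype.card X + 1 - 1 = Fintype.card X := by omega
  rw [e1, Nat.choose_zero_right, mul_one] at h0
  rw [e2, e4, Nat.choose_one_right, mul_comm] at h1
  rw [add_zero] at h0
  rw [h0, h1, h2, e3] at h
  rw [h, Nat.add_sub_cancel]
  push_cast
  ring

end Degree

section Multidegree

variable {X : Type*} [Fintype X] [DecidableEq X]

/-- Every letter occurs in `L`, so a two-element multiset fails to lie below `L` exactly when it is
`{x, x}` with `x` of multiplicity 1. This is the source of the term `w`. -/
theorem card_submultisets_two {L : Multiset X} (hL : ∀ x, 1 ≤ L.count x) :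
    Nat.card {b : {b : Multiset X // b ≤ L} // Multiset.card b.1 = 2} +
      (Finset.univ.filter fun x => L.count x = 1).card = (Fintype.card X + 1).choose 2 := by
  have h := Sym.card_sym_eq_choose (α := X) 2
  rw [show Fintype.card X + 2 - 1 = Fintype.card X + 1 by omega] at h
  have hle : ∀ s : Sym X 2, ¬ (s : Multiset X) ≤ L ↔
      ∃ x, L.count x = 1 ∧ Sym.replicate 2 x = s := by
    rintro ⟨s, hs⟩
    obtain ⟨a, b, rfl⟩ := Multiset.card_eq_two.1 hs
    by_cases hab : a = b
    · subst hab
      have h' : ({a, a} : Multiset X) = Multiset.replicate 2 a := rfl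
      change ¬ ({a, a} : Multiset X) ≤ L ↔ _
      have h'' : ({a, a} : Multiset X) ≤ L ↔ 2 ≤ L.count a := by
        rw [h', ← Multiset.le_count_iff_replicate_le]
      rw [h'']
      have ha := hL a
      refine ⟨fun h => ⟨a, by omega, rfl⟩, ?_⟩
      rintro ⟨x, hx, hxa⟩
      have hxa : Multiset.replicate 2 x = Multiset.replicate 2 a := congrArg Subtype.val hxa
      obtain rfl := Multiset.replicate_right_injective two_ne_zero hxa
      omega
    · refine iff_of_false (not_not.2 ?_) ?_
      · change ({a, b} : Multiset X) ≤ L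
        rw [Multiset.le_iff_subset (by simpa using hab)]
        exact fun x _ => Multiset.one_le_count_iff_mem.1 (hL x)
      · rintro ⟨x, -, hx⟩
        have hx : Multiset.replicate 2 x = {a, b} := congrArg Subtype.val hx
        have ha : a ∈ Multiset.replicate 2 x := hx ▸ by simp
        have hb : b ∈ Multiset.replicate 2 x := hx ▸ by simp
        exact hab ((Multiset.eq_of_mem_replicate ha).trans (Multiset.eq_of_mem_replicate hb).symm)
  have e : {b : {b : Multiset X // b ≤ L} // Multiset.card b.1 = 2} ≃
      {s : Sym X 2 // (s : Multiset X) ≤ L} :=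
    { toFun b := ⟨⟨b.1.1, b.2⟩, b.1.2⟩
      invFun s := ⟨⟨s.1.1, s.2⟩, s.1.2⟩
      left_inv _ := rfl
      right_inv _ := rfl }
  rw [Nat.card_congr e, Nat.card_eq_fintype_card, Fintype.card_subtype, ← h, ← Finset.card_univ,
    ← Finset.card_filter_add_card_filter_not (s := (Finset.univ : Finset (Sym X 2)))
      (fun s : Sym X 2 => ↑s ≤ L)]
  congr 1
  refine Finset.card_bij (fun x _ => Sym.replicate 2 x) ?_ ?_ ?_
  · intro x hx
    rw [Finset.mem_filter] at hx ⊢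
    exact ⟨Finset.mem_univ _, (hle _).2 ⟨x, hx.2, rfl⟩⟩
  · intro x _ y _ hxy
    exact Multiset.replicate_right_injective two_ne_zero (congrArg Subtype.val hxy)
  · intro s hs
    rw [Finset.mem_filter] at hs
    obtain ⟨x, hx, hxs⟩ := (hle s).1 hs.2
    exact ⟨x, Finset.mem_filter.2 ⟨Finset.mem_univ _, hx⟩, hxs⟩

theorem card_pairs_multidegree {L : Multiset X} (hL : ∀ x, 1 ≤ L.count x) :
    (Nat.card {q : {p : Multiset X × Multiset X // p.1 + p.2 = L} //
      3 ≤ Multiset.card q.1.2} : ℤ) =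
      ∏ x, ((L.count x : ℤ) + 1) - ((Fintype.card X + 1).choose 2 : ℤ) - (Fintype.card X : ℤ) - 1
          + ((Finset.univ.filter fun x => L.count x = 1).card : ℤ) := by
  -- The second part determines the first as `L - b`, so the pairs are the submultisets of `L`, of
  -- which there are `∏ (count + 1)`.
  let e : {p : Multiset X × Multiset X // p.1 + p.2 = L} ≃ {b : Multiset X // b ≤ L} :=
    { toFun p := ⟨p.1.2, (Multiset.le_add_left _ _).trans_eq p.2⟩
      invFun b := ⟨(L - b.1, b.1), Multiset.sub_add_cancel b.2⟩
      left_inv p := by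
        obtain ⟨⟨a, b⟩, rfl⟩ := p
        simp
      right_inv _ := rfl }
  have hfin : Finite {b : Multiset X // b ≤ L} := Set.finite_Iic L
  have h := Nat.card_eq_card_three_le_add (fun b : {b : Multiset X // b ≤ L} =>
    Multiset.card b.1)
  have hIic : Nat.card {b : Multiset X // b ≤ L} = ∏ x, (L.count x + 1) := by
    have hs : L.toFinset = Finset.univ := by
      ext x
      simpa using Multiset.one_le_count_iff_mem.1 (hL x)
    rw [← hs, ← Multiset.card_Iic]
    exact Nat.subtype_card _ fun _ => Finset.mem_Iic
  have h0 : Nat.card {b : {b : Multiset X // b ≤ L} // Multiset.card b.1 = 0} = 1 := by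
    rw [Nat.card_eq_one_iff_unique]
    refine ⟨⟨fun a b => Subtype.ext (Subtype.ext ?_)⟩, ⟨⟨⟨0, Multiset.zero_le _⟩, rfl⟩⟩⟩
    rw [Multiset.card_eq_zero.1 a.2, Multiset.card_eq_zero.1 b.2]
  have h1 : Nat.card {b : {b : Multiset X // b ≤ L} // Multiset.card b.1 = 1} =
      Fintype.card X := by
    rw [← Nat.card_eq_fintype_card]
    refine (Nat.card_congr (Equiv.ofBijective (fun x => ⟨⟨{x}, Multiset.singleton_le.2
      (Multiset.one_le_count_iff_mem.1 (hL x))⟩, Multiset.card_singleton x⟩) ⟨?_, ?_⟩)).symm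
    · intro x y hxy
      simpa using hxy
    · rintro ⟨⟨b, hb⟩, hb'⟩
      obtain ⟨x, rfl⟩ := Multiset.card_eq_one.1 hb'
      exact ⟨x, rfl⟩
  have h2 := card_submultisets_two hL
  have h3 : Nat.card {q : {p : Multiset X × Multiset X // p.1 + p.2 = L} //
      3 ≤ Multiset.card q.1.2} =
      Nat.card {b : {b : Multiset X // b ≤ L} // 3 ≤ Multiset.card b.1} :=
    Nat.card_congr (e.subtypeEquiv fun _ => Iff.rfl)
  rw [← h3, h0, h1, hIic] at h
  clear h3 hIic h0 h1
  generalize Nat.card _ = a at h ⊢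
  generalize Nat.card _ = b at h h2
  generalize Finset.card _ = c at h2 ⊢
  zify at h h2
  linarith

end Multidegree

end IsAssosymmetric

/-! ### The dimension formulas -/

namespace FreeAssosymmetric

open IsAssosymmetric

theorem occ_eq_count_content {X : Type*} [DecidableEq X] (x : X) (w : FreeMagma X) :
    occ x w = w.content.count x := by
  induction w with
  | ih1 y =>
    change (if y = x then 1 else 0) = Multiset.count x {y}
    simp only [Multiset.count_singleton, eq_comm]
  | ih2 u v hu hv =>
    rw [FreeMagma.content_mul, Multiset.count_add, ← hu, ← hv]
    rfl

theorem length_eq_card_content {X : Type*} (w : FreeMagma X) :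
    w.length = Multiset.card w.content := by
  induction w with
  | ih1 y => rfl
  | ih2 u v hu hv =>
    rw [FreeMagma.content_mul, Multiset.card_add, ← hu, ← hv]
    rfl

variable {K : Type*} [Field K]

theorem finrank_multiComponent (h2 : ringChar K ≠ 2) (h3 : ringChar K ≠ 3) {r : ℕ}
    (l : Fin r → ℕ) (hr : 1 ≤ r) (hl : ∀ i, 1 ≤ l i) :
    Module.Finite K (multiComponent K l) ∧
      (Module.finrank K (multiComponent K l) : ℤ) =
        (Nat.multinomial Finset.univ l : ℤ) + ∏ i, ((l i : ℤ) + 1)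
          - ((r + 1).choose 2 : ℤ) - (r : ℤ) - 1
          + ((Finset.univ.filter fun i => l i = 1).card : ℤ) := by
  obtain ⟨L, hL⟩ : ∃ L : Multiset (Fin r), ∀ i, L.count i = l i :=
    ⟨Finsupp.toMultiset (Finsupp.equivFunOnFinite.symm l), fun i => by
      rw [Finsupp.count_toMultiset]; rfl⟩
  have hL0 : L ≠ 0 := by
    rintro rfl
    have := hl ⟨0, hr⟩
    rw [← hL, Multiset.count_zero] at this
    omega
  have hW : multiComponent K l = Submodule.span K
      {p | ∃ w : FreeMagma (Fin r), w.content ∈ ({L} : Set _) ∧ word K w = p} := by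
    simp only [multiComponent, occ_eq_count_content, ← hL, ← Multiset.ext, Set.mem_singleton_iff]
  have := finite_normalIndex (X := Fin r) (Multiset.card L) (S := {L}) (by simp)
  obtain ⟨hf, hd⟩ := finrank_span_words h2 h3 {L} hW
  refine ⟨hf, ?_⟩
  rw [hd, card_normalIndex {L} (by simpa using hL0.symm), Nat.cast_add]
  have e1 := Multiset.card_lists_eq_multinomial L
  have e2 := card_pairs_multidegree (L := L) (fun i => (hl i).trans_eq (hL i).symm)
  simp only [hL, Fintype.card_fin] at e1 e2
  refine (congrArg₂ (fun a b : ℤ => a + b) (congrArg Nat.cast e1) e2).trans ?_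
  ring

theorem finrank_degComponent (h2 : ringChar K ≠ 2) (h3 : ringChar K ≠ 3) (r : ℕ) {n : ℕ}
    (hn : 1 ≤ n) :
    Module.Finite K (degComponent K r n) ∧
      (Module.finrank K (degComponent K r n) : ℤ) =
        (r : ℤ) ^ n + ((n + 2 * r - 1).choose n : ℤ)
          - ((r + 1).choose 2 : ℤ) * (if n = 1 then 0 else ((n + r - 3).choose (n - 2) : ℤ))
          - (r : ℤ) * ((n + r - 2).choose (n - 1) : ℤ)
          - ((n + r - 1).choose n : ℤ) := by
  have hW : degComponent K r n = Submodule.span K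
      {p | ∃ w : FreeMagma (Fin r), w.content ∈ {m | Multiset.card m = n} ∧ word K w = p} := by
    simp only [degComponent, length_eq_card_content]
    rfl
  have := finite_normalIndex (X := Fin r) n (S := {m | Multiset.card m = n}) (fun _ h => h)
  obtain ⟨hf, hd⟩ := finrank_span_words h2 h3 {m | Multiset.card m = n} hW
  refine ⟨hf, ?_⟩
  rw [hd, card_normalIndex _ (by simp; omega), Nat.cast_add]
  have e1 : Nat.card {l : List (Fin r) // (l : Multiset (Fin r)) ∈
      {m : Multiset (Fin r) | Multiset.card m = n}} = r ^ n := by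
    refine Eq.trans (b := Nat.card (List.Vector (Fin r) n)) rfl ?_
    rw [Nat.card_eq_fintype_card, card_vector, Fintype.card_fin]
  have e2 := card_pairs_degree (X := Fin r) hn
  rw [Fintype.card_fin] at e2
  have e3 : Nat.card {q : {p : Multiset (Fin r) × Multiset (Fin r) //
      p.1 + p.2 ∈ {m : Multiset (Fin r) | Multiset.card m = n}} // 3 ≤ Multiset.card q.1.2} =
      Nat.card {q : {p : Multiset (Fin r) × Multiset (Fin r) //
        Multiset.card p.1 + Multiset.card p.2 = n} // 3 ≤ Multiset.card q.1.2} :=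
    Nat.card_congr (Equiv.subtypeEquiv (Equiv.subtypeEquivRight fun p => by
      rw [← Multiset.card_add]; rfl) fun _ => Iff.rfl)
  rw [e1, e3, e2]
  push_cast
  ring

theorem finrank_multilinearPart (h2 : ringChar K ≠ 2) (h3 : ringChar K ≠ 3) {n : ℕ}
    (hn : 1 ≤ n) :
    Module.Finite K (multilinearPart K n) ∧
      (Module.finrank K (multilinearPart K n) : ℤ) =
        (n.factorial : ℤ) + 2 ^ n - ((n + 1).choose 2 : ℤ) - 1 := by
  obtain ⟨hf, hd⟩ := finrank_multiComponent h2 h3 (fun _ : Fin n => 1) hn fun _ => le_rfl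
  refine ⟨hf, hd.trans ?_⟩
  have hm : Nat.multinomial Finset.univ (fun _ : Fin n => 1) = n.factorial := by
    simp [Nat.multinomial]
  rw [hm, Finset.filter_true_of_mem fun _ _ => rfl, Finset.card_univ, Finset.prod_const,
    Finset.card_univ, Fintype.card_fin]
  push_cast
  ring

end FreeAssosymmetric

theorem theorem2p1 (K : Type*) [Field K] (h2 : ringChar K ≠ 2) (h3 : ringChar K ≠ 3) :
    (∀ (r : ℕ) (l : Fin r → ℕ), 1 ≤ r → (∀ i, 1 ≤ l i) →
      Module.Finite K (FreeAssosymmetric.multiComponent K l) ∧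
      (Module.finrank K (FreeAssosymmetric.multiComponent K l) : ℤ) =
        (Nat.multinomial Finset.univ l : ℤ) + ∏ i, ((l i : ℤ) + 1)
          - ((r + 1).choose 2 : ℤ) - (r : ℤ) - 1
          + ((Finset.univ.filter fun i => l i = 1).card : ℤ)) ∧
    (∀ r n : ℕ, 1 ≤ r → 1 ≤ n →
      Module.Finite K (FreeAssosymmetric.degComponent K r n) ∧
      (Module.finrank K (FreeAssosymmetric.degComponent K r n) : ℤ) =
        (r : ℤ) ^ n + ((n + 2 * r - 1).choose n : ℤ)
          - ((r + 1).choose 2 : ℤ) * (if n = 1 then 0 else ((n + r - 3).choose (n - 2) : ℤ))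
          - (r : ℤ) * ((n + r - 2).choose (n - 1) : ℤ)
          - ((n + r - 1).choose n : ℤ)) ∧
    (∀ n : ℕ, 1 ≤ n →
      Module.Finite K (FreeAssosymmetric.multilinearPart K n) ∧
      (Module.finrank K (FreeAssosymmetric.multilinearPart K n) : ℤ) =
        (n.factorial : ℤ) + 2 ^ n - ((n + 1).choose 2 : ℤ) - 1) :=
  ⟨fun _ l hr hl => FreeAssosymmetric.finrank_multiComponent h2 h3 l hr hl,
    fun r _ _ hn => FreeAssosymmetric.finrank_degComponent h2 h3 r hn,
    fun _ hn => FreeAssosymmetric.finrank_multilinearPart h2 h3 hn⟩
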